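/- Let $\mathcal H$ be a separable quaternionic (right) Hilbert space, let $J$ be a bounded right linear operator on $\mathcal H$ that is anti-selfadjoint and unitary, and let $i\in\mathbb H$ be an imaginary unit ($\operatorname{Re} i=0$, $|i|=1$). Put $\mathcal H_+^{Ji}=\{x\in\mathcal H : Jx=xi\}$, a complex Hilbert space over $\mathbb C_i=\mathbb R+i\mathbb R$. For a compact right linear operator $T$ on $\mathcal H$ let $\lambda_1(T)\ge\lambda_2(T)\ge\dots\ge 0$ be its singular values, i.e. the eigenvalues of $|T|=(T^*T)^{1/2}$ in decreasing order, repeated according to multiplicity and followed by zeros if there are only finitely many. For $0<p<\infty$ let $S_p(J)$ be the set of compact $T$ with $TJ=JT$ and $\sum_n\lambda_n(T)^p<\infty$, and let $\|T\|_p=\big(\sum_n\lambda_n(T)^p\big)^{1/p}\in[0,\infty]$. Orthonormal sets $\{e_n\}$ may be finite or infinite. **Theorem.** Let $T$ be a compact right linear operator on $\mathcal H$ with $[T,J]=TJ-JT=0$. 1. Let $2\le p<\infty$. Then $T\in S_p(J)$ if and only if $\sum_n\|Te_n\|^p<\infty$ for all orthonormal sets $\{e_n\}$ in $\mathcal H_+^{Ji}$.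 Moreover, $$\|T\|_p=\sup\Big\{\Big[\sum_n\|Te_n\|^p\Big]^{1/p} : \{e_n\}\text{ orthonormal in }\mathcal H_+^{Ji}\Big\}.$$ 2. Let $1\le p<\infty$. Then $T\in S_p(J)$ if and only if $\sum_n|\langle e_n,Te_n\rangle|^p<\infty$ for all orthonormal sets $\{e_n\}$ in $\mathcal H_+^{Ji}$. If $T$ is also selfadjoint, then $$\|T\|_p=\sup\Big\{\Big[\sum_n|\langle e_n,Te_n\rangle|^p\Big]^{1/p} : \{e_n\}\text{ orthonormal in }\mathcal H_+^{Ji}\Big\}.$$ 3. Let $1\le p<\infty$. Then $T\in S_p(J)$ if and only if $\sum_n|\langle \sigma_n,Te_n\rangle|^p<\infty$ for all orthonormal sets $\{e_n\}$ and $\{\sigma_n\}$ in $\mathcal H_+^{Ji}$ (with the same index set). If $T$ is also positive, then $$\|T\|_p=\sup\Big\{\Big[\sum_n|\langle \sigma_n,Te_n\rangle|^p\Big]^{1/p} : \{e_n\},\{\sigma_n\}\text{ orthonormal in }\mathcal H_+^{Ji}\Big\}.$$ 4. Let $0<p\le 2$. Then for every orthonormal basis $\{e_n\}$ of the complex Hilbert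 space $\mathcal H_+^{Ji}$, $$\|T\|_p^p\le\sum_n\sum_k|\langle e_k,Te_n\rangle|^p$$ (both sides may be $+\infty$). -/

import Mathlib

open scoped Quaternion ENNReal

namespace QuatSchatten

/-- Right quaternionic inner product space: a right vector space over `ℍ` (that is, a module over
`ℍᵐᵒᵖ`, the vector `x a` being `MulOpposite.op a • x`) with an `ℍ`-valued scalar product that is
right-linear in its second argument and hermitian. The last axiom says that the norm is
`√⟨x, x⟩`; positivity and definiteness of the scalar product are contained in it, since `‖·‖`
is a norm. A quaternionic Hilbert space is such a space that is also complete. -/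
class QuaternionicInnerProductSpace (H : Type*) [NormedAddCommGroup H] extends
    Module ℍᵐᵒᵖ H, Inner ℍ H where
  inner_add_right : ∀ x y z : H, inner x (y + z) = inner x y + inner x z
  inner_smul_right : ∀ (x y : H) (a : ℍ), inner x (MulOpposite.op a • y) = inner x y * a
  star_inner : ∀ x y : H, star (inner x y) = inner y x
  inner_self_eq : ∀ x : H, inner x x = ((‖x‖ ^ 2 : ℝ) : ℍ)

section Adjoint

variable {H : Type*} [NormedAddCommGroup H] [QuaternionicInnerProductSpace H]

theorem qinner_add_left (x y z : H) : inner ℍ (x + y) z = inner ℍ x z + inner ℍ y z := by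
  rw [← QuaternionicInnerProductSpace.star_inner z, QuaternionicInnerProductSpace.inner_add_right,
    star_add, QuaternionicInnerProductSpace.star_inner, QuaternionicInnerProductSpace.star_inner]

theorem qinner_smul_left (x y : H) (a : ℍ) :
    inner ℍ (MulOpposite.op a • x) y = star a * inner ℍ x y := by
  rw [← QuaternionicInnerProductSpace.star_inner y, QuaternionicInnerProductSpace.inner_smul_right,
    star_mul, QuaternionicInnerProductSpace.star_inner]

theorem qext_inner {x y : H} (h : ∀ z, inner ℍ x z = inner ℍ y z) : x = y := by
  have h1 : ∀ z, inner ℍ (x - y) z = 0 := by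
    intro z
    have h2 := qinner_add_left (x - y) y z
    rw [sub_add_cancel, h z] at h2
    simpa using h2.symm
  have h3 := h1 (x - y)
  rw [QuaternionicInnerProductSpace.inner_self_eq] at h3
  have h4 : ‖x - y‖ ^ 2 = 0 := Quaternion.coe_injective (by rw [h3, Quaternion.coe_zero])
  exact sub_eq_zero.1 (norm_eq_zero.1 (by simpa using h4))

/-- Existence of the adjoint, through the real Hilbert space with scalar product `Re ⟨x, y⟩`. -/
theorem exists_adjoint [CompleteSpace H] (T : H →L[ℍᵐᵒᵖ] H) :
    ∃ S : H →L[ℍᵐᵒᵖ] H, ∀ x y : H, inner ℍ (S x) y = inner ℍ x (T y) := by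
  let : Module ℝ H := Module.compHom H (algebraMap ℝ ℍᵐᵒᵖ)
  have smul_def : ∀ (r : ℝ) (x : H), r • x = MulOpposite.op (r : ℍ) • x := fun r x => rfl
  let : NormedSpace ℝ H :=
    { norm_smul_le := by
        intro r x
        have h1 : (((‖r • x‖ ^ 2 : ℝ)) : ℍ) = (((‖r‖ * ‖x‖) ^ 2 : ℝ) : ℍ) := by
          rw [← QuaternionicInnerProductSpace.inner_self_eq, smul_def,
            QuaternionicInnerProductSpace.inner_smul_right, qinner_smul_left,
            QuaternionicInnerProductSpace.inner_self_eq]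
          rw [Quaternion.star_coe, ← Quaternion.coe_mul, ← Quaternion.coe_mul]
          congr 1
          rw [mul_pow, Real.norm_eq_abs, sq_abs]
          ring
        have h2 : ‖r • x‖ ^ 2 = (‖r‖ * ‖x‖) ^ 2 := Quaternion.coe_injective h1
        exact le_of_eq ((sq_eq_sq₀ (norm_nonneg _) (by positivity)).1 h2) }
  let : InnerProductSpace ℝ H :=
    { inner := fun x y => (inner ℍ x y).re
      norm_sq_eq_re_inner := by
        intro x
        exact (congrArg (fun q : ℍ => q.re)
          (QuaternionicInnerProductSpace.inner_self_eq x)).symm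
      conj_inner_symm := by
        intro x y
        rw [← QuaternionicInnerProductSpace.star_inner x y]
        simp
      add_left := by
        intro x y z
        simp [qinner_add_left]
      smul_left := by
        intro x y r
        simp [smul_def, qinner_smul_left] }
  have inner_def : ∀ x y : H, inner ℝ x y = (inner ℍ x y).re := fun x y => rfl
  let Tr : H →L[ℝ] H :=
    { toFun := T
      map_add' := T.map_add
      map_smul' := fun r x => T.map_smul _ x
      cont := T.continuous }
  let A : H →L[ℝ] H := ContinuousLinearMap.adjoint Tr
  have hA : ∀ x y : H, inner ℍ (A x) y = inner ℍ x (T y) := by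
    intro x y
    have h1 : ∀ a : ℍ, (inner ℍ (A x) y * a).re = (inner ℍ x (T y) * a).re := by
      intro a
      rw [← QuaternionicInnerProductSpace.inner_smul_right,
        ← QuaternionicInnerProductSpace.inner_smul_right, ← T.map_smul]
      exact ContinuousLinearMap.adjoint_inner_left Tr (MulOpposite.op a • y) x
    have h2 := h1 (star (inner ℍ (A x) y - inner ℍ x (T y)))
    rw [← sub_eq_zero, ← Quaternion.re_sub, ← sub_mul, ← Quaternion.normSq_def,
      Quaternion.normSq_eq_zero] at h2
    exact sub_eq_zero.1 h2
  refine ⟨{ toFun := A, map_add' := A.map_add, map_smul' := ?_, cont := A.continuous }, hA⟩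
  intro a x
  apply qext_inner
  intro z
  have h1 : inner ℍ (A (a • x)) z = inner ℍ (a • A x) z := by
    rw [hA, ← MulOpposite.op_unop a, qinner_smul_left, qinner_smul_left, hA]
  exact h1

/-- The adjoint `T*`: the operator with `⟨T* x, y⟩ = ⟨x, T y⟩` for all `x`, `y`. -/
noncomputable def adjoint [CompleteSpace H] (T : H →L[ℍᵐᵒᵖ] H) : H →L[ℍᵐᵒᵖ] H :=
  Classical.choose (exists_adjoint T)

theorem qadjoint_inner_left [CompleteSpace H] (T : H →L[ℍᵐᵒᵖ] H) (x y : H) :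
    inner ℍ (adjoint T x) y = inner ℍ x (T y) :=
  Classical.choose_spec (exists_adjoint T) x y

end Adjoint

section Definitions

variable {H : Type*} [NormedAddCommGroup H] [QuaternionicInnerProductSpace H]

/-- Orthonormal families with respect to the quaternionic scalar product. -/
def IsOrthonormal {ι : Type*} (e : ι → H) : Prop :=
  (∀ k, ‖e k‖ = 1) ∧ ∀ k l, k ≠ l → inner ℍ (e k) (e l) = 0

/-- `T` is positive: `⟨x, T x⟩` is a nonnegative real number for every `x`. -/
def IsPositive (T : H →L[ℍᵐᵒᵖ] H) : Prop :=
  ∀ x : H, ∃ r : ℝ, 0 ≤ r ∧ inner ℍ x (T x) = (r : ℍ)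

/-- `J` is anti-selfadjoint and unitary. -/
def IsAntiSelfAdjointUnitary [CompleteSpace H] (J : H →L[ℍᵐᵒᵖ] H) : Prop :=
  adjoint J = -J ∧ adjoint J * J = 1 ∧ J * adjoint J = 1

/-- The complex subspace `H₊^{Ji} = {x : J x = x i}`. -/
def HPlus (J : H →L[ℍᵐᵒᵖ] H) (i : ℍ) : Set H :=
  {x | J x = MulOpposite.op i • x}

/-- `e` is an orthonormal family (a finite or infinite one) of vectors of `H₊^{Ji}`. -/
def IsOrthonormalIn (J : H →L[ℍᵐᵒᵖ] H) (i : ℍ) {ι : Type*} (e : ι → H) : Prop :=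
  IsOrthonormal e ∧ ∀ k, e k ∈ HPlus J i

/-- `e` is an orthonormal basis of the complex Hilbert space `H₊^{Ji}`: an orthonormal family in
it such that only the zero vector of `H₊^{Ji}` is orthogonal to all its members. -/
def IsOrthonormalBasisOf (J : H →L[ℍᵐᵒᵖ] H) (i : ℍ) {ι : Type*} (e : ι → H) : Prop :=
  IsOrthonormalIn J i e ∧ ∀ x ∈ HPlus J i, (∀ k, inner ℍ (e k) x = 0) → x = 0

/-- The `n`-th singular value of `T` (`n = 0, 1, 2, …`): the `(n+1)`-st largest eigenvalue of
`|T| = (T* T)^{1/2}`, that is, the `(n+1)`-st largest square root of an eigenvalue of `T* T`,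
repeated according to multiplicity. It is the largest `s` for which there are `n + 1` orthonormal
eigenvectors of `T* T` with eigenvalues `μ_k ^ 2`, `μ_k ≥ s`, and it is `0` if there are no
`n + 1` orthonormal eigenvectors. -/
noncomputable def singularValue [CompleteSpace H] (T : H →L[ℍᵐᵒᵖ] H) (n : ℕ) : ℝ :=
  sSup {s : ℝ | 0 ≤ s ∧ ∃ (e : Fin (n + 1) → H) (μ : Fin (n + 1) → ℝ), IsOrthonormal e ∧
    ∀ k, s ≤ μ k ∧ adjoint T (T (e k)) = MulOpposite.op ((μ k ^ 2 : ℝ) : ℍ) • e k}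

/-- The `(J, p)`-Schatten class `S_p(J)`, for `0 < p < ∞`. -/
def schattenClass [CompleteSpace H] (J : H →L[ℍᵐᵒᵖ] H) (p : ℝ) : Set (H →L[ℍᵐᵒᵖ] H) :=
  {T | IsCompactOperator T ∧ T * J = J * T ∧ Summable fun n => singularValue T n ^ p}

/-- `‖T‖_p`, the `ℓ^p` (quasi-)norm of the sequence of singular values, for `0 < p < ∞`; it has
the value `∞` if the sequence is not in `ℓ^p`. -/
noncomputable def schattenNorm [CompleteSpace H] (p : ℝ) (T : H →L[ℍᵐᵒᵖ] H) : ℝ≥0∞ :=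
  (∑' n, ENNReal.ofReal (singularValue T n) ^ p) ^ (1 / p)

end Definitions

end QuatSchatten

open QuatSchatten

namespace QuatSchatten

open Filter Topology

/-! ### Orthonormal expansions over the quaternions: Bessel, Cauchy–Schwarz, Parseval. -/

section Basic

variable {H : Type*} [NormedAddCommGroup H] [QuaternionicInnerProductSpace H]

/-! `T* T` is compact, selfadjoint and commutes with `J`, so it has an orthonormal eigenbasis `g_k`
inside `H₊`, with eigenvalues `μ_k ^ 2` (`exists_eigenbasis`). A family of `H₊` that is total there
is total in all of `H` (`isTotal_of_HPlus`), so Parseval holds in `H`. Counting eigenvectors above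
each level `t ≥ 0` identifies the positive `μ_k` with the positive singular values, hence `∑ λ_n ^ p
= ∑ μ_k ^ p` (`tsum_singularValue_rpow`).

The upper bounds are Jensen's inequality with doubly substochastic weights. First, `‖T e_n‖ ^ 2 =
∑_k |⟨g_k, e_n⟩| ^ 2 μ_k ^ 2`, and the weights sum to at most 1 over `k` and over `n`; the power `p
/ 2` is convex for `p ≥ 2`. Second, with `h_k = T g_k / μ_k`, one has `⟨σ_n, T e_n⟩ = ∑_k ⟨σ_n, h_k⟩
μ_k ⟨g_k, e_n⟩`, and the products `|⟨h_k, σ_n⟩| |⟨g_k, e_n⟩|` are such weights too. The bounds are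
attained at `e = g`, `σ = h`, or, for the diagonal of a selfadjoint `T`, at an eigenbasis of `T`.
For `p ≤ 2` the power `p / 2` is concave, Jensen reverses, and its subadditivity splits `‖T e_n‖ ^
p` into matrix entries.

For the converse in the diagonal criterion, `A = T + T*` and `B = J (T - T*)` are selfadjoint and
commute with `J`. Since `J` changes no modulus of an entry against a vector of `H₊`, their diagonals
are at most twice that of `T`; evaluated on their own eigenbases this makes their singular values
`p`-summable. The entries `⟨h_k, T g_k⟩ = μ_k` are controlled by those of `A` and `B`. -/

theorem qinner_add_right (x y z : H) : inner ℍ x (y + z) = inner ℍ x y + inner ℍ x z :=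
  QuaternionicInnerProductSpace.inner_add_right x y z

theorem qinner_smul_right (x y : H) (a : ℍ) :
    inner ℍ x (MulOpposite.op a • y) = inner ℍ x y * a :=
  QuaternionicInnerProductSpace.inner_smul_right x y a

theorem star_qinner (x y : H) : star (inner ℍ x y) = inner ℍ y x :=
  QuaternionicInnerProductSpace.star_inner x y

theorem qinner_self (x : H) : inner ℍ x x = ((‖x‖ ^ 2 : ℝ) : ℍ) :=
  QuaternionicInnerProductSpace.inner_self_eq x

theorem norm_qinner_comm (x y : H) : ‖inner ℍ x y‖ = ‖inner ℍ y x‖ := by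
  rw [← star_qinner, Quaternion.norm_star]

theorem enorm_qinner_comm (x y : H) : ‖inner ℍ x y‖ₑ = ‖inner ℍ y x‖ₑ := by
  rw [← ofReal_norm, ← ofReal_norm, norm_qinner_comm]

/-- The scalar product as an additive map in its second argument. -/
def qinnerRight (x : H) : H →+ ℍ := AddMonoidHom.mk' (fun y => inner ℍ x y) (qinner_add_right x)

/-- The scalar product as an additive map in its first argument. -/
def qinnerLeft (y : H) : H →+ ℍ :=
  AddMonoidHom.mk' (fun x => inner ℍ x y) fun x z => qinner_add_left x z y

@[simp] theorem qinner_zero_right (x : H) : inner ℍ x (0 : H) = 0 := map_zero (qinnerRight x)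

@[simp] theorem qinner_zero_left (x : H) : inner ℍ (0 : H) x = 0 := map_zero (qinnerLeft x)

theorem qinner_sub_right (x y z : H) : inner ℍ x (y - z) = inner ℍ x y - inner ℍ x z :=
  map_sub (qinnerRight x) y z

theorem qinner_sub_left (x y z : H) : inner ℍ (x - y) z = inner ℍ x z - inner ℍ y z :=
  map_sub (qinnerLeft z) x y

theorem qinner_neg_left (x y : H) : inner ℍ (-x) y = -inner ℍ x y := map_neg (qinnerLeft y) x

theorem qinner_sum_right {ι : Type*} (F : Finset ι) (x : H) (f : ι → H) :
    inner ℍ x (∑ k ∈ F, f k) = ∑ k ∈ F, inner ℍ x (f k) := map_sum (qinnerRight x) f F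

theorem qinner_sum_left {ι : Type*} (F : Finset ι) (x : H) (f : ι → H) :
    inner ℍ (∑ k ∈ F, f k) x = ∑ k ∈ F, inner ℍ (f k) x := map_sum (qinnerLeft x) f F

theorem star_mul_self_eq_norm_sq (a : ℍ) : star a * a = ((‖a‖ ^ 2 : ℝ) : ℍ) := by
  rw [Quaternion.star_mul_self, Quaternion.normSq_eq_norm_mul_self, sq]

theorem norm_op_smul (a : ℍ) (x : H) : ‖MulOpposite.op a • x‖ = ‖a‖ * ‖x‖ := by
  have h : ((‖MulOpposite.op a • x‖ ^ 2 : ℝ) : ℍ) = (((‖a‖ * ‖x‖) ^ 2 : ℝ) : ℍ) := by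
    rw [← qinner_self, qinner_smul_right, qinner_smul_left, qinner_self, mul_assoc,
      Quaternion.coe_commutes, ← mul_assoc, star_mul_self_eq_norm_sq, mul_pow, Quaternion.coe_mul]
  exact (sq_eq_sq₀ (norm_nonneg _) (by positivity)).1 (Quaternion.coe_injective h)

/-- Supplies the continuity of scalar multiplication used in all limit arguments. -/
instance : NormSMulClass ℍᵐᵒᵖ H where
  norm_smul a x := by
    rw [← MulOpposite.op_unop a, norm_op_smul, MulOpposite.norm_op]

/-- Pythagoras: the projection `P` has the same coefficients as `x`, so `⟨P, x⟩`, `⟨x, P⟩` and `⟨P,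
P⟩` all agree. -/
theorem norm_sub_sum_sq {ι : Type*} {e : ι → H} (he : IsOrthonormal e) (F : Finset ι) (x : H) :
    ‖x - ∑ k ∈ F, MulOpposite.op (inner ℍ (e k) x) • e k‖ ^ 2 =
      ‖x‖ ^ 2 - ∑ k ∈ F, ‖inner ℍ (e k) x‖ ^ 2 := by
  classical
  set P := ∑ k ∈ F, MulOpposite.op (inner ℍ (e k) x) • e k with hP
  have h1 : ∀ k ∈ F, inner ℍ (e k) P = inner ℍ (e k) x := by
    intro k hk
    rw [hP, qinner_sum_right, Finset.sum_eq_single k]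
    · simp [qinner_smul_right, qinner_self, he.1]
    · intro l _ hl
      rw [qinner_smul_right, he.2 k l hl.symm, zero_mul]
    · exact fun h => absurd hk h
  have h2 : inner ℍ P x = ((∑ k ∈ F, ‖inner ℍ (e k) x‖ ^ 2 : ℝ) : ℍ) := by
    have h : ((∑ k ∈ F, ‖inner ℍ (e k) x‖ ^ 2 : ℝ) : ℍ) =
        ∑ k ∈ F, ((‖inner ℍ (e k) x‖ ^ 2 : ℝ) : ℍ) := map_sum (algebraMap ℝ ℍ) _ _
    rw [hP, qinner_sum_left, h]
    exact Finset.sum_congr rfl fun k _ => by rw [qinner_smul_left, star_mul_self_eq_norm_sq]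
  have h3 : inner ℍ P P = ((∑ k ∈ F, ‖inner ℍ (e k) x‖ ^ 2 : ℝ) : ℍ) := by
    rw [← h2]
    nth_rewrite 1 [hP]
    nth_rewrite 2 [hP]
    rw [qinner_sum_left, qinner_sum_left]
    refine Finset.sum_congr rfl fun k hk => ?_
    rw [qinner_smul_left, qinner_smul_left, h1 k hk]
  have h4 : inner ℍ x P = ((∑ k ∈ F, ‖inner ℍ (e k) x‖ ^ 2 : ℝ) : ℍ) := by
    rw [← star_qinner, h2, Quaternion.star_coe]
  apply Quaternion.coe_injective
  rw [← qinner_self, qinner_sub_left, qinner_sub_right, qinner_sub_right, h2, h3, h4, qinner_self,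
    sub_self, sub_zero, Quaternion.coe_sub]

theorem sum_norm_sq_le {ι : Type*} {e : ι → H} (he : IsOrthonormal e) (F : Finset ι) (x : H) :
    ∑ k ∈ F, ‖inner ℍ (e k) x‖ ^ 2 ≤ ‖x‖ ^ 2 := by
  have := norm_sub_sum_sq he F x
  nlinarith [sq_nonneg ‖x - ∑ k ∈ F, MulOpposite.op (inner ℍ (e k) x) • e k‖]

/-- The normalization of a nonzero vector has norm one. -/
theorem norm_normalize {x : H} (hx : x ≠ 0) : ‖MulOpposite.op ((‖x‖⁻¹ : ℝ) : ℍ) • x‖ = 1 := by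
  rw [norm_op_smul, Quaternion.norm_coe, norm_inv, norm_norm,
    inv_mul_cancel₀ (norm_ne_zero_iff.2 hx)]

/-- Bessel's inequality for the single vector `x / ‖x‖`. -/
theorem norm_qinner_le (x y : H) : ‖inner ℍ x y‖ ≤ ‖x‖ * ‖y‖ := by
  by_cases hx : x = 0
  · simp [hx]
  have he : IsOrthonormal fun _ : Unit => MulOpposite.op ((‖x‖⁻¹ : ℝ) : ℍ) • x :=
    ⟨fun _ => norm_normalize hx, fun k l h => absurd (Subsingleton.elim k l) h⟩
  have h := sum_norm_sq_le he Finset.univ y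
  rw [Finset.univ_unique, Finset.sum_singleton, qinner_smul_left, norm_mul, Quaternion.norm_star,
    Quaternion.norm_coe, norm_inv, norm_norm] at h
  have h1 := (sq_le_sq₀ (by positivity) (by positivity)).1 h
  rwa [inv_mul_le_iff₀ (norm_pos_iff.2 hx)] at h1

theorem continuous_qinner_right (x : H) : Continuous fun y : H => inner ℍ x y :=
  AddMonoidHomClass.continuous_of_bound (qinnerRight x) ‖x‖ (norm_qinner_le x)

/-- A family is complete if only the zero vector is orthogonal to all its members. -/
def IsTotal {ι : Type*} (e : ι → H) : Prop := ∀ x : H, (∀ k, inner ℍ (e k) x = 0) → x = 0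

theorem summable_norm_sq {ι : Type*} {e : ι → H} (he : IsOrthonormal e) (x : H) :
    Summable fun k => ‖inner ℍ (e k) x‖ ^ 2 :=
  summable_of_sum_le (fun _ => by positivity) fun F => sum_norm_sq_le he F x

theorem norm_sum_sq {ι : Type*} {e : ι → H} (he : IsOrthonormal e) (F : Finset ι) (a : ι → ℍ) :
    ‖∑ k ∈ F, MulOpposite.op (a k) • e k‖ ^ 2 = ∑ k ∈ F, ‖a k‖ ^ 2 := by
  classical
  set P := ∑ k ∈ F, MulOpposite.op (a k) • e k with hP
  have h1 : ∀ k ∈ F, inner ℍ (e k) P = a k := by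
    intro k hk
    rw [hP, qinner_sum_right, Finset.sum_eq_single k]
    · simp [qinner_smul_right, qinner_self, he.1]
    · intro l _ hl
      rw [qinner_smul_right, he.2 k l hl.symm, zero_mul]
    · exact fun h => absurd hk h
  have h2 := norm_sub_sum_sq he F P
  have h3 : ∑ k ∈ F, MulOpposite.op (inner ℍ (e k) P) • e k = P :=
    Finset.sum_congr rfl fun k hk => by rw [h1 k hk]
  rw [h3, sub_self, norm_zero, Finset.sum_congr rfl fun k hk => by rw [h1 k hk]] at h2
  linarith

/-- Bessel makes the partial sums Cauchy; the difference between `x` and the limit is orthogonal to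
every `e k`, so totality kills it. -/
theorem hasSum_expansion [CompleteSpace H] {ι : Type*} {e : ι → H} (he : IsOrthonormal e)
    (ht : IsTotal e) (x : H) : HasSum (fun k => MulOpposite.op (inner ℍ (e k) x) • e k) x := by
  classical
  have hs : Summable fun k => MulOpposite.op (inner ℍ (e k) x) • e k := by
    rw [summable_iff_vanishing_norm]
    intro ε hε
    obtain ⟨s, hs⟩ := summable_iff_vanishing_norm.1 (summable_norm_sq he x) (ε ^ 2) (by positivity)
    refine ⟨s, fun t ht => ?_⟩
    have h := hs t ht
    rw [← norm_sum_sq he, Real.norm_eq_abs, abs_of_nonneg (by positivity)] at h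
    exact lt_of_pow_lt_pow_left₀ 2 hε.le h
  obtain ⟨y, hy⟩ := hs
  have hxy : x - y = 0 := by
    apply ht
    intro k
    have h1 : HasSum (fun l => inner ℍ (e k) (MulOpposite.op (inner ℍ (e l) x) • e l))
        (inner ℍ (e k) y) := hy.map (qinnerRight (e k)) (continuous_qinner_right (e k))
    have h2 := hasSum_single (f := fun l => inner ℍ (e k) (MulOpposite.op (inner ℍ (e l) x) • e l))
      k fun l hl => by rw [qinner_smul_right, he.2 k l hl.symm, zero_mul]
    rw [qinner_sub_right, h1.unique h2, qinner_smul_right, qinner_self, he.1]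
    simp
  rwa [← sub_eq_zero.1 hxy] at hy

theorem hasSum_qinner_mul [CompleteSpace H] {ι : Type*} {e : ι → H} (he : IsOrthonormal e)
    (ht : IsTotal e) (x y : H) : HasSum (fun k => inner ℍ x (e k) * inner ℍ (e k) y)
      (inner ℍ x y) := by
  have h := (hasSum_expansion he ht y).map (qinnerRight x) (continuous_qinner_right x)
  have h' : HasSum (fun k => inner ℍ x (MulOpposite.op (inner ℍ (e k) y) • e k)) (inner ℍ x y) := h
  simpa only [qinner_smul_right] using h'

theorem tsum_enorm_sq_le {ι : Type*} {e : ι → H} (he : IsOrthonormal e) (x : H) :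
    ∑' k, ‖inner ℍ (e k) x‖ₑ ^ 2 ≤ ‖x‖ₑ ^ 2 := by
  rw [ENNReal.tsum_eq_iSup_sum]
  refine iSup_le fun F => ?_
  simp_rw [← ofReal_norm, ← ENNReal.ofReal_pow (norm_nonneg _)]
  rw [← ENNReal.ofReal_sum_of_nonneg fun _ _ => by positivity]
  exact ENNReal.ofReal_le_ofReal (sum_norm_sq_le he F x)

theorem hasSum_norm_sq [CompleteSpace H] {ι : Type*} {e : ι → H} (he : IsOrthonormal e)
    (ht : IsTotal e) (x : H) : HasSum (fun k => ‖inner ℍ (e k) x‖ ^ 2) (‖x‖ ^ 2) := by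
  have h := hasSum_qinner_mul he ht x x
  rw [qinner_self] at h
  refine Quaternion.hasSum_coe.1 ?_
  simpa only [← star_mul_self_eq_norm_sq, star_qinner] using h

theorem tsum_enorm_sq [CompleteSpace H] {ι : Type*} {e : ι → H} (he : IsOrthonormal e)
    (ht : IsTotal e) (x : H) : ∑' k, ‖inner ℍ (e k) x‖ₑ ^ 2 = ‖x‖ₑ ^ 2 := by
  have h := hasSum_norm_sq he ht x
  simp_rw [← ofReal_norm, ← ENNReal.ofReal_pow (norm_nonneg _)]
  rw [← ENNReal.ofReal_tsum_of_nonneg (fun _ => by positivity) h.summable, h.tsum_eq]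

theorem enorm_qinner_le_tsum [CompleteSpace H] {ι : Type*} {e : ι → H} (he : IsOrthonormal e)
    (ht : IsTotal e) (x y : H) :
    ‖inner ℍ x y‖ₑ ≤ ∑' k, ‖inner ℍ x (e k)‖ₑ * ‖inner ℍ (e k) y‖ₑ := by
  have h := hasSum_qinner_mul he ht x y
  rw [← h.tsum_eq]
  refine enorm_tsum_le_tsum_enorm.trans_eq ?_
  simp_rw [enorm_mul]

end Basic

/-! ### Compact operators, adjoints, and existence of an eigenvector. -/

section Operators

variable {H : Type*} [NormedAddCommGroup H] [QuaternionicInnerProductSpace H]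

theorem exists_bound (T : H →L[ℍᵐᵒᵖ] H) : ∃ C : ℝ, 0 ≤ C ∧ ∀ x, ‖T x‖ ≤ C * ‖x‖ := by
  have h0 : Tendsto T (𝓝 0) (𝓝 0) := by simpa using T.continuous.tendsto 0
  obtain ⟨δ, hδ, h⟩ := Metric.tendsto_nhds_nhds.1 h0 1 one_pos
  refine ⟨2 / δ, by positivity, fun x => ?_⟩
  by_cases hx : x = 0
  · simp [hx]
  have hx' : 0 < ‖x‖ := norm_pos_iff.2 hx
  have hn : ‖((δ / (2 * ‖x‖) : ℝ) : ℍ)‖ = δ / (2 * ‖x‖) := by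
    rw [Quaternion.norm_coe, Real.norm_of_nonneg (by positivity)]
  have h1 := @h (MulOpposite.op ((δ / (2 * ‖x‖) : ℝ) : ℍ) • x) (by
    rw [dist_zero_right, norm_op_smul, hn]
    field_simp
    linarith)
  rw [map_smul, dist_zero_right, norm_op_smul, hn] at h1
  have h2 : ‖T x‖ = 2 / δ * ‖x‖ * (δ / (2 * ‖x‖) * ‖T x‖) := by field_simp
  rw [h2]
  exact mul_le_of_le_one_right (by positivity) h1.le

theorem op_coe_smul_smul (r s : ℝ) (x : H) :
    MulOpposite.op (r : ℍ) • MulOpposite.op (s : ℍ) • x = MulOpposite.op ((r * s : ℝ) : ℍ) • x := by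
  rw [smul_smul, ← MulOpposite.op_mul, ← Quaternion.coe_mul, mul_comm s r]

theorem op_coe_one_smul (x : H) : MulOpposite.op ((1 : ℝ) : ℍ) • x = x := by
  rw [Quaternion.coe_one, MulOpposite.op_one, one_smul]

/-- Compactness only provides a neighbourhood of 0 with relatively compact image, so the sequence is
shrunk into it by `δ / 2` and the limit scaled back. -/
theorem exists_tendsto_subseq {T : H →L[ℍᵐᵒᵖ] H} (hT : IsCompactOperator T) {x : ℕ → H}
    (hx : ∀ n, ‖x n‖ ≤ 1) :
    ∃ (y : H) (φ : ℕ → ℕ), StrictMono φ ∧ Tendsto (fun n => T (x (φ n))) atTop (𝓝 y) := by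
  obtain ⟨K, hK, hTK⟩ := hT
  obtain ⟨δ, hδ, h⟩ := Metric.mem_nhds_iff.1 hTK
  have h1 : ∀ n, T (MulOpposite.op ((δ / 2 : ℝ) : ℍ) • x n) ∈ K := fun n => h (by
    rw [mem_ball_zero_iff, norm_op_smul, Quaternion.norm_coe, Real.norm_of_nonneg (by positivity)]
    nlinarith [hx n])
  obtain ⟨z, -, φ, hφ, hz⟩ := hK.tendsto_subseq h1
  refine ⟨MulOpposite.op ((2 / δ : ℝ) : ℍ) • z, φ, hφ, ?_⟩
  have h2 := hz.const_smul (MulOpposite.op ((2 / δ : ℝ) : ℍ))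
  refine h2.congr fun n => ?_
  rw [Function.comp_apply, map_smul, op_coe_smul_smul, show 2 / δ * (δ / 2) = 1 by field_simp,
    op_coe_one_smul]

theorem norm_sub_smul_sq {u x : H} {c : ℝ} (h : inner ℍ u x = (c : ℍ)) (r : ℝ) :
    ‖u - MulOpposite.op (r : ℍ) • x‖ ^ 2 = ‖u‖ ^ 2 - 2 * r * c + r ^ 2 * ‖x‖ ^ 2 := by
  apply Quaternion.coe_injective
  have h' : inner ℍ x u = (c : ℍ) := by rw [← star_qinner, h, Quaternion.star_coe]
  rw [← qinner_self, qinner_sub_left, qinner_sub_right, qinner_sub_right, qinner_smul_left,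
    qinner_smul_left, qinner_smul_right, qinner_smul_right, qinner_self, qinner_self, h, h',
    Quaternion.star_coe]
  simp only [← Quaternion.coe_mul, ← Quaternion.coe_sub]
  congr 1
  ring

theorem isCompactOperator_of_subseq {T : H →L[ℍᵐᵒᵖ] H}
    (h : ∀ x : ℕ → H, (∀ n, ‖x n‖ ≤ 1) →
      ∃ (y : H) (φ : ℕ → ℕ), StrictMono φ ∧ Tendsto (fun n => T (x (φ n))) atTop (𝓝 y)) :
    IsCompactOperator T := by
  refine ⟨closure (T '' Metric.closedBall 0 1), ?_, mem_of_superset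
    (Metric.closedBall_mem_nhds 0 one_pos) fun x hx => subset_closure ⟨x, hx, rfl⟩⟩
  rw [isCompact_iff_isSeqCompact]
  intro u hu
  have h1 : ∀ n : ℕ, ∃ x : H, ‖x‖ ≤ 1 ∧ dist (u n) (T x) < 1 / ((n : ℝ) + 1) := fun n => by
    obtain ⟨_, ⟨x, hx, rfl⟩, hd⟩ := Metric.mem_closure_iff.1 (hu n) (1 / ((n : ℝ) + 1))
      (by positivity)
    exact ⟨x, by simpa using hx, hd⟩
  choose x hx hd using h1
  obtain ⟨y, φ, hφ, hy⟩ := h x hx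
  refine ⟨y, isClosed_closure.mem_of_tendsto hy (Eventually.of_forall fun n =>
    subset_closure ⟨x (φ n), by simpa using hx (φ n), rfl⟩), φ, hφ, ?_⟩
  have h2 : Tendsto (fun n => dist (T (x (φ n))) (u (φ n))) atTop (𝓝 0) := by
    refine squeeze_zero (fun _ => dist_nonneg) (fun n => ?_)
      ((tendsto_one_div_add_atTop_nhds_zero_nat (𝕜 := ℝ)).comp hφ.tendsto_atTop)
    rw [dist_comm]
    exact (hd (φ n)).le
  exact (tendsto_iff_of_dist h2).1 hy

section Adjoint

variable [CompleteSpace H]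

theorem qadjoint_inner_right (T : H →L[ℍᵐᵒᵖ] H) (x y : H) :
    inner ℍ x (adjoint T y) = inner ℍ (T x) y := by
  rw [← star_qinner, qadjoint_inner_left, star_qinner]

theorem adjoint_eq_of_inner {T S : H →L[ℍᵐᵒᵖ] H} (h : ∀ x y, inner ℍ (S x) y = inner ℍ x (T y)) :
    adjoint T = S := by
  ext x
  exact qext_inner fun y => by rw [qadjoint_inner_left, h]

theorem adjoint_adjoint (T : H →L[ℍᵐᵒᵖ] H) : adjoint (adjoint T) = T :=
  adjoint_eq_of_inner fun x y => (qadjoint_inner_right T x y).symm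

theorem adjoint_add (T S : H →L[ℍᵐᵒᵖ] H) : adjoint (T + S) = adjoint T + adjoint S :=
  adjoint_eq_of_inner fun x y => by
    simp only [add_apply, qinner_add_left, qinner_add_right,
      qadjoint_inner_left]

theorem adjoint_sub (T S : H →L[ℍᵐᵒᵖ] H) : adjoint (T - S) = adjoint T - adjoint S :=
  adjoint_eq_of_inner fun x y => by
    simp only [sub_apply, qinner_sub_left, qinner_sub_right,
      qadjoint_inner_left]

theorem adjoint_mul (T S : H →L[ℍᵐᵒᵖ] H) : adjoint (T * S) = adjoint S * adjoint T :=
  adjoint_eq_of_inner fun x y => by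
    simp only [mul_apply_eq_comp, qadjoint_inner_left]

theorem inner_adjoint_apply_self (T : H →L[ℍᵐᵒᵖ] H) (x : H) :
    inner ℍ x (adjoint T (T x)) = ((‖T x‖ ^ 2 : ℝ) : ℍ) := by
  rw [qadjoint_inner_right, qinner_self]

theorem isCompactOperator_adjoint_mul_self {T : H →L[ℍᵐᵒᵖ] H} (hT : IsCompactOperator T) :
    IsCompactOperator (adjoint T * T : H →L[ℍᵐᵒᵖ] H) :=
  hT.clm_comp (adjoint T)

/-- Schauder's theorem through `‖T* w‖ ^ 2 ≤ ‖w‖ ‖T T* w‖`: where `T T*` converges along a bounded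
sequence, `T*` is Cauchy. -/
theorem isCompactOperator_adjoint {T : H →L[ℍᵐᵒᵖ] H} (hT : IsCompactOperator T) :
    IsCompactOperator (adjoint T) := by
  refine isCompactOperator_of_subseq fun x hx => ?_
  have hc : IsCompactOperator (T * adjoint T : H →L[ℍᵐᵒᵖ] H) := hT.comp_clm (adjoint T)
  obtain ⟨y, φ, hφ, hy⟩ := exists_tendsto_subseq hc hx
  suffices hs : CauchySeq fun n => adjoint T (x (φ n)) by
    obtain ⟨z, hz⟩ := cauchySeq_tendsto_of_complete hs
    exact ⟨z, φ, hφ, hz⟩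
  rw [Metric.cauchySeq_iff']
  intro ε hε
  -- Differences of vectors of the unit ball have norm at most 2, whence `ε ^ 2 / 2`.
  obtain ⟨N, hN⟩ := Metric.cauchySeq_iff'.1 hy.cauchySeq (ε ^ 2 / 2) (by positivity)
  refine ⟨N, fun n hn => ?_⟩
  have h1 := hN n hn
  rw [dist_eq_norm, ← map_sub] at h1 ⊢
  set w := x (φ n) - x (φ N) with hw
  have h2 : ‖w‖ ≤ 2 := (norm_sub_le _ _).trans (by linarith [hx (φ n), hx (φ N)])
  have h3 : ‖adjoint T w‖ ^ 2 ≤ ‖w‖ * ‖(T * adjoint T) w‖ := by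
    have h4 := norm_qinner_le w (T (adjoint T w))
    rw [← qadjoint_inner_left, qinner_self, Quaternion.norm_coe,
      Real.norm_of_nonneg (by positivity)] at h4
    exact h4
  have h5 : ‖adjoint T w‖ ^ 2 < ε ^ 2 := by
    nlinarith [norm_nonneg w, norm_nonneg ((T * adjoint T) w)]
  exact lt_of_pow_lt_pow_left₀ 2 hε.le h5

/-- A maximizer `y` of `‖A x‖` on the unit sphere of `M`, with maximum `m`, satisfies `A (A y) = y m
^ 2`, and factoring `A ^ 2 - m ^ 2` yields an eigenvector for `m` or `-m`. Only real scalars are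
required to preserve `M`, because `H₊` is not a quaternionic subspace. -/
theorem exists_eigenvector {A : H →L[ℍᵐᵒᵖ] H} (hA : IsCompactOperator A) (hs : adjoint A = A)
    {M : Set H} (hM : IsClosed M) (hadd : ∀ x ∈ M, ∀ y ∈ M, x + y ∈ M)
    (hsmul : ∀ x ∈ M, ∀ r : ℝ, MulOpposite.op (r : ℍ) • x ∈ M) (hAM : ∀ x ∈ M, A x ∈ M)
    (hne : ∃ x ∈ M, x ≠ 0) :
    ∃ x ∈ M, ‖x‖ = 1 ∧ ∃ r : ℝ, A x = MulOpposite.op (r : ℍ) • x := by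
  have hs' : ∀ x y, inner ℍ (A x) y = inner ℍ x (A y) := fun x y => by
    nth_rewrite 1 [← hs]
    exact qadjoint_inner_left A x y
  obtain ⟨C, hC0, hC⟩ := exists_bound A
  obtain ⟨x₀, hx₀, hx₀0⟩ := hne
  set V : Set ℝ := {t | ∃ x ∈ M, ‖x‖ = 1 ∧ t = ‖A x‖} with hV
  have hVb : BddAbove V := ⟨C, by
    rintro _ ⟨x, -, hx, rfl⟩
    simpa [hx] using hC x⟩
  have hVn : V.Nonempty := ⟨_, _, hsmul _ hx₀ _, norm_normalize hx₀0, rfl⟩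
  set m := sSup V with hm
  have hm1 : ∀ x ∈ M, ‖x‖ = 1 → ‖A x‖ ≤ m := fun x hx h1 => le_csSup hVb ⟨x, hx, h1, rfl⟩
  have hm2 : ∀ x ∈ M, ‖A x‖ ≤ m * ‖x‖ := by
    intro x hx
    by_cases h0 : x = 0
    · simp [h0]
    have h := hm1 _ (hsmul _ hx _) (norm_normalize h0)
    rw [map_smul, norm_op_smul, Quaternion.norm_coe, norm_inv, norm_norm,
      inv_mul_le_iff₀ (norm_pos_iff.2 h0)] at h
    linarith
  have hm0 : 0 ≤ m := by
    obtain ⟨_, x, hx, h1, rfl⟩ := hVn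
    exact (norm_nonneg _).trans (hm1 x hx h1)
  rcases hm0.eq_or_lt with hm0 | hm0
  · obtain ⟨_, x, hx, h1, rfl⟩ := hVn
    refine ⟨x, hx, h1, 0, ?_⟩
    have h2 := hm1 x hx h1
    rw [← hm0] at h2
    simpa using h2
  obtain ⟨u, -, hu, huV⟩ := exists_seq_tendsto_sSup hVn hVb
  choose x hxM hx1 hux using huV
  obtain ⟨z, φ, hφ, hz⟩ := exists_tendsto_subseq hA fun n => (hx1 n).le
  have hAz : Tendsto (fun n => A (A (x (φ n)))) atTop (𝓝 (A z)) :=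
    (A.continuous.tendsto z).comp hz
  have hlim : Tendsto (fun n => A (A (x (φ n))) - MulOpposite.op ((m ^ 2 : ℝ) : ℍ) • x (φ n))
      atTop (𝓝 0) := by
    -- Expanding the square gives `‖A A x‖ ^ 2 - 2 m ^ 2 ‖A x‖ ^ 2 + m ^ 4`, and `‖A A x‖ ≤ m ‖A
    -- x‖`.
    have hb : ∀ n, ‖A (A (x (φ n))) - MulOpposite.op ((m ^ 2 : ℝ) : ℍ) • x (φ n)‖ ^ 2 ≤
        m ^ 2 * (m ^ 2 - u (φ n) ^ 2) := by
      intro n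
      have h1 : inner ℍ (A (A (x (φ n)))) (x (φ n)) = ((‖A (x (φ n))‖ ^ 2 : ℝ) : ℍ) := by
        rw [hs', qinner_self]
      rw [norm_sub_smul_sq h1, hx1, ← hux]
      have h2 := hm2 _ (hAM _ (hxM (φ n)))
      rw [← hux] at h2
      have h3 := pow_le_pow_left₀ (norm_nonneg _) h2 2
      nlinarith
    have ht : Tendsto (fun n => m ^ 2 * (m ^ 2 - u (φ n) ^ 2)) atTop (𝓝 0) := by
      have := (((hu.comp hφ.tendsto_atTop).pow 2).const_sub (m ^ 2)).const_mul (m ^ 2)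
      rwa [← hm, sub_self, mul_zero] at this
    have h2 := (squeeze_zero (fun n => by positivity) hb ht).sqrt
    rw [tendsto_zero_iff_norm_tendsto_zero]
    simpa [Real.sqrt_sq] using h2
  have hx : Tendsto (fun n => x (φ n)) atTop
      (𝓝 (MulOpposite.op (((m ^ 2)⁻¹ : ℝ) : ℍ) • A z)) := by
    have h1 := (hAz.sub hlim).const_smul (MulOpposite.op (((m ^ 2)⁻¹ : ℝ) : ℍ))
    rw [sub_zero] at h1
    refine h1.congr fun n => ?_
    rw [sub_sub_cancel, op_coe_smul_smul, inv_mul_cancel₀ (by positivity), op_coe_one_smul]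
  set y := MulOpposite.op (((m ^ 2)⁻¹ : ℝ) : ℍ) • A z with hy
  have hyM : y ∈ M := hM.mem_of_tendsto hx (Eventually.of_forall fun n => hxM _)
  have hy1 : ‖y‖ = 1 := tendsto_nhds_unique hx.norm (by simp [hx1])
  have hAy : A (A y) = MulOpposite.op ((m ^ 2 : ℝ) : ℍ) • y := by
    have h1 := ((A.continuous.comp A.continuous).tendsto y).comp hx
    have h2 := h1.sub (hx.const_smul (MulOpposite.op ((m ^ 2 : ℝ) : ℍ)))
    exact sub_eq_zero.1 (tendsto_nhds_unique h2 hlim)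
  clear_value y
  -- `(A - m) (A + m) y = 0`: either `w = (A + m) y` vanishes and `y` has eigenvalue `-m`, or `w`
  -- has eigenvalue `m`.
  obtain ⟨w, hwdef⟩ : ∃ w, w = A y + MulOpposite.op (m : ℍ) • y := ⟨_, rfl⟩
  have hwM : w ∈ M := hwdef ▸ hadd _ (hAM _ hyM) _ (hsmul _ hyM m)
  have hAw : A w = MulOpposite.op (m : ℍ) • w := by
    rw [hwdef, map_add, map_smul, hAy, smul_add, op_coe_smul_smul, sq, add_comm]
  by_cases hw : w = 0
  · refine ⟨y, hyM, hy1, -m, ?_⟩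
    rw [Quaternion.coe_neg, MulOpposite.op_neg, neg_smul]
    exact eq_neg_of_add_eq_zero_left (hwdef.symm.trans hw)
  · refine ⟨_, hsmul w hwM _, norm_normalize hw, m, ?_⟩
    rw [map_smul, hAw, op_coe_smul_smul, op_coe_smul_smul, mul_comm]

end Adjoint

end Operators

/-! ### The slice `H₊` and the spectral theorem inside it. -/

section Spectral

theorem star_eq_neg_of_re {i : ℍ} (hi : i.re = 0) : star i = -i := Quaternion.star_eq_neg.2 hi

theorem mul_self_eq_neg_one {i : ℍ} (hi : i.re = 0) (hn : ‖i‖ = 1) : i * i = -1 := by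
  have h := star_mul_self_eq_norm_sq i
  rw [star_eq_neg_of_re hi, hn, neg_mul, one_pow, Quaternion.coe_one] at h
  rw [← h, neg_neg]

/-- Every commutator `i u - u i` anticommutes with `i`, because `i * i = -1`. If all of them
vanished, `i` would be central, hence real, hence 0. -/
theorem exists_anticommuting {i : ℍ} (hi : i.re = 0) (hn : ‖i‖ = 1) :
    ∃ w : ℍ, w ≠ 0 ∧ w * i = -(i * w) := by
  have hii := mul_self_eq_neg_one hi hn
  by_cases h : ∃ u : ℍ, i * u - u * i ≠ 0
  · obtain ⟨u, hu⟩ := h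
    refine ⟨_, hu, ?_⟩
    rw [sub_mul, mul_sub, ← mul_assoc i i u, mul_assoc u i i, hii, mul_assoc]
    simp
  · push Not at h
    obtain ⟨u, hu0, hu1, hu2, hu3⟩ : ∃ u : ℍ, u.re = 0 ∧ u.imI = 1 ∧ u.imJ = 0 ∧ u.imK = 0 :=
      ⟨⟨0, 1, 0, 0⟩, rfl, rfl, rfl, rfl⟩
    obtain ⟨v, hv0, hv1, hv2, hv3⟩ : ∃ v : ℍ, v.re = 0 ∧ v.imI = 0 ∧ v.imJ = 1 ∧ v.imK = 0 :=
      ⟨⟨0, 0, 1, 0⟩, rfl, rfl, rfl, rfl⟩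
    have h1 := congrArg (fun q : ℍ => q.imJ) (h u)
    have h2 := congrArg (fun q : ℍ => q.imK) (h u)
    have h3 := congrArg (fun q : ℍ => q.imK) (h v)
    simp only [Quaternion.imJ_sub, Quaternion.imK_sub, Quaternion.imJ_mul, Quaternion.imK_mul,
      hu0, hu1, hu2, hu3, hv0, hv1, hv2, hv3, Quaternion.imJ_zero, Quaternion.imK_zero] at h1 h2 h3
    have h0 : i = 0 := by
      ext <;> simp only [Quaternion.re_zero, Quaternion.imI_zero, Quaternion.imJ_zero,
        Quaternion.imK_zero] <;> linarith
    simp [h0] at hn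

variable {H : Type*} [NormedAddCommGroup H] [QuaternionicInnerProductSpace H]

theorem isClosed_HPlus (J : H →L[ℍᵐᵒᵖ] H) (i : ℍ) : IsClosed (HPlus J i) :=
  isClosed_eq J.continuous (continuous_const_smul _)

theorem apply_mem_HPlus {J A : H →L[ℍᵐᵒᵖ] H} {i : ℍ} (hAJ : A * J = J * A) {x : H}
    (hx : x ∈ HPlus J i) : A x ∈ HPlus J i := by
  have h : A (J x) = J (A x) := congrArg (fun S : H →L[ℍᵐᵒᵖ] H => S x) hAJ
  have hx' : J x = MulOpposite.op i • x := hx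
  change J (A x) = MulOpposite.op i • A x
  rw [← h, hx', map_smul]

theorem op_coe_smul_mem_HPlus {J : H →L[ℍᵐᵒᵖ] H} {i : ℍ} {x : H} (hx : x ∈ HPlus J i) (r : ℝ) :
    MulOpposite.op (r : ℍ) • x ∈ HPlus J i := by
  have hx' : J x = MulOpposite.op i • x := hx
  change J _ = _
  rw [map_smul, hx', smul_smul, smul_smul, ← MulOpposite.op_mul, ← MulOpposite.op_mul,
    Quaternion.coe_commutes]

/-- Distinct members are at distance `√2`, so balls of radius `1 / 2` around them are disjoint. -/
theorem countable_of_orthonormal [TopologicalSpace.SeparableSpace H] {S : Set H}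
    (hS : IsOrthonormal (Subtype.val : S → H)) : S.Countable := by
  refine Set.PairwiseDisjoint.countable_of_isOpen (s := fun x => Metric.ball x (1 / 2)) ?_
    (fun _ _ => Metric.isOpen_ball) fun x _ => ⟨x, Metric.mem_ball_self (by norm_num)⟩
  intro x hx y hy hxy
  refine Metric.ball_disjoint_ball ?_
  have h0 : inner ℍ x y = ((0 : ℝ) : ℍ) := by
    rw [Quaternion.coe_zero]
    exact hS.2 ⟨x, hx⟩ ⟨y, hy⟩ fun h => hxy (congrArg Subtype.val h)
  have h1 := norm_sub_smul_sq h0 1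
  have hx1 : ‖x‖ = 1 := hS.1 ⟨x, hx⟩
  have hy1 : ‖y‖ = 1 := hS.1 ⟨y, hy⟩
  rw [op_coe_one_smul, hx1, hy1] at h1
  rw [dist_eq_norm]
  nlinarith [norm_nonneg (x - y)]

variable [CompleteSpace H]

theorem J_apply_J {J : H →L[ℍᵐᵒᵖ] H} (hJ : IsAntiSelfAdjointUnitary J) (x : H) :
    J (J x) = -x := by
  have h := congrArg (fun S : H →L[ℍᵐᵒᵖ] H => S x) hJ.2.1
  rw [hJ.1] at h
  exact neg_eq_iff_eq_neg.1 h

theorem qinner_J_left {J : H →L[ℍᵐᵒᵖ] H} (hJ : IsAntiSelfAdjointUnitary J) (x y : H) :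
    inner ℍ (J x) y = -inner ℍ x (J y) := by
  rw [← qadjoint_inner_left, hJ.1, ← qinner_neg_left, neg_apply, neg_neg]

/-- If `x` is orthogonal to all `e k`, so is `J x`. The vector `J x + x i` lies in `H₊`, hence is 0,
so `J x = -x i`; right multiplication by some `w ≠ 0` anticommuting with `i` then moves `x` into
`H₊`, where it must vanish. -/
theorem isTotal_of_HPlus {J : H →L[ℍᵐᵒᵖ] H} (hJ : IsAntiSelfAdjointUnitary J) {i : ℍ}
    (hi : i.re = 0) (hn : ‖i‖ = 1) {ι : Type*} {e : ι → H} (he : ∀ k, e k ∈ HPlus J i)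
    (ht : ∀ x ∈ HPlus J i, (∀ k, inner ℍ (e k) x = 0) → x = 0) : IsTotal e := by
  have hii := mul_self_eq_neg_one hi hn
  intro x hx
  have hJx : ∀ k, inner ℍ (e k) (J x) = 0 := by
    intro k
    have hk : J (e k) = MulOpposite.op i • e k := he k
    rw [← neg_eq_zero, ← qinner_J_left hJ, hk, qinner_smul_left, hx, mul_zero]
  have h1 : J x + MulOpposite.op i • x = 0 := by
    refine ht _ ?_ fun k => by rw [qinner_add_right, qinner_smul_right, hx, hJx, zero_mul, add_zero]
    change J (J x + MulOpposite.op i • x) = MulOpposite.op i • (J x + MulOpposite.op i • x)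
    rw [map_add, map_smul, J_apply_J hJ, smul_add, smul_smul, ← MulOpposite.op_mul, hii,
      MulOpposite.op_neg, MulOpposite.op_one, neg_smul, one_smul, add_comm]
  obtain ⟨w, hw0, hw⟩ := exists_anticommuting hi hn
  have h2 : MulOpposite.op w • x = 0 := by
    refine ht _ ?_ fun k => by rw [qinner_smul_right, hx, zero_mul]
    change J (MulOpposite.op w • x) = MulOpposite.op i • MulOpposite.op w • x
    rw [map_smul, eq_neg_of_add_eq_zero_left h1, smul_neg, smul_smul, smul_smul,
      ← MulOpposite.op_mul, ← MulOpposite.op_mul, hw, MulOpposite.op_neg, neg_smul]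
  have h3 := congrArg norm h2
  rw [norm_op_smul, norm_zero] at h3
  exact norm_eq_zero.1 ((mul_eq_zero.1 h3).resolve_left (norm_ne_zero_iff.2 hw0))

/-- The spectral theorem for compact selfadjoint operators commuting with `J`. -/
theorem exists_eigenbasis [TopologicalSpace.SeparableSpace H] {J : H →L[ℍᵐᵒᵖ] H}
    (hJ : IsAntiSelfAdjointUnitary J) {i : ℍ} (hi : i.re = 0) (hn : ‖i‖ = 1)
    {A : H →L[ℍᵐᵒᵖ] H} (hA : IsCompactOperator A) (hs : adjoint A = A) (hAJ : A * J = J * A) :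
    ∃ (S : Set H) (r : S → ℝ), S.Countable ∧ IsOrthonormalIn J i (Subtype.val : S → H) ∧
      IsTotal (Subtype.val : S → H) ∧ ∀ k : S, A k = MulOpposite.op (r k : ℍ) • (k : H) := by
  let E : Set H := {x | ‖x‖ = 1 ∧ x ∈ HPlus J i ∧ ∃ r : ℝ, A x = MulOpposite.op (r : ℍ) • x}
  let Q : Set (Set H) := {S | S ⊆ E ∧ S.Pairwise fun x y => inner ℍ x y = 0}
  -- Zorn: a maximal orthonormal set of eigenvectors lying in `H₊`.
  obtain ⟨S, hSm⟩ : ∃ S, Maximal (· ∈ Q) S := by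
    refine zorn_subset Q fun c hcQ hc => ⟨⋃₀ c, ⟨Set.sUnion_subset fun s hs => (hcQ hs).1, ?_⟩,
      fun s hs => Set.subset_sUnion_of_mem hs⟩
    exact (Set.pairwise_sUnion hc.directedOn).2 fun s hs => (hcQ hs).2
  have hSQ : S ∈ Q := hSm.prop
  have horth : IsOrthonormal (Subtype.val : S → H) :=
    ⟨fun k => (hSQ.1 k.2).1, fun k l h => hSQ.2 k.2 l.2 fun h' => h (Subtype.ext h')⟩
  choose r hr using fun k : S => (hSQ.1 k.2).2.2
  refine ⟨S, r, countable_of_orthonormal horth, ⟨horth, fun k => (hSQ.1 k.2).2.1⟩, ?_, hr⟩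
  refine isTotal_of_HPlus hJ hi hn (fun k : S => (hSQ.1 k.2).2.1) fun x hx hxS => ?_
  by_contra hx0
  -- The orthogonal complement of `S` in `H₊` is invariant under `A`. Were it nonzero, it would
  -- contain a unit eigenvector, which maximality puts into `S`, making it orthogonal to itself.
  let M : Set H := HPlus J i ∩ ⋂ k : S, {x | inner ℍ (k : H) x = 0}
  have hM : ∀ {x}, x ∈ M ↔ x ∈ HPlus J i ∧ ∀ k : S, inner ℍ (k : H) x = 0 := by
    intro x
    simp only [M, Set.mem_inter_iff, Set.mem_iInter, Set.mem_ofPred_eq]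
  obtain ⟨y, hyM, hy1, hyr⟩ := exists_eigenvector hA hs (M := M)
    ((isClosed_HPlus J i).inter (isClosed_iInter fun k =>
      isClosed_eq (continuous_qinner_right _) continuous_const))
    (fun x hx y hy => hM.2 ⟨by
      have h1 : J x = _ := (hM.1 hx).1
      have h2 : J y = _ := (hM.1 hy).1
      change J (x + y) = _
      rw [map_add, h1, h2, smul_add], fun k => by
        rw [qinner_add_right, (hM.1 hx).2, (hM.1 hy).2, add_zero]⟩)
    (fun x hx r => hM.2 ⟨op_coe_smul_mem_HPlus (hM.1 hx).1 r, fun k => by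
      rw [qinner_smul_right, (hM.1 hx).2, zero_mul]⟩)
    (fun x hx => hM.2 ⟨apply_mem_HPlus hAJ (hM.1 hx).1, fun k => by
      rw [← qadjoint_inner_left, hs, hr, qinner_smul_left, (hM.1 hx).2, mul_zero]⟩)
    ⟨x, hM.2 ⟨hx, hxS⟩, hx0⟩
  have hyS : y ∈ S := by
    have hQ : insert y S ∈ Q := by
      refine ⟨Set.insert_subset ⟨hy1, (hM.1 hyM).1, hyr⟩ hSQ.1, hSQ.2.insert fun z hz _ => ?_⟩
      have h := (hM.1 hyM).2 ⟨z, hz⟩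
      exact ⟨by rw [← star_qinner, h, star_zero], h⟩
    exact hSm.le_of_ge hQ (Set.subset_insert y S) (Set.mem_insert y S)
  have h := (hM.1 hyM).2 ⟨y, hyS⟩
  rw [qinner_self, hy1] at h
  simp at h

end Spectral

/-! ### Singular values and eigenvalues compared by counting. -/

section Counting

open MeasureTheory in
-- The layer-cake formula for counting measure: the sum of `p`-th powers depends only on the sizes
-- of the superlevel sets.
theorem tsum_ofReal_rpow_eq_of_encard_eq {α β : Type*} {f : α → ℝ} {g : β → ℝ} (hf : ∀ a, 0 ≤ f a)
    (hg : ∀ b, 0 ≤ g b) (h : ∀ t, 0 ≤ t → {a | t < f a}.encard = {b | t < g b}.encard)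
    {p : ℝ} (hp : 0 < p) : ∑' a, ENNReal.ofReal (f a) ^ p = ∑' b, ENNReal.ofReal (g b) ^ p := by
  let _ : MeasurableSpace α := ⊤
  let _ : MeasurableSpace β := ⊤
  simp_rw [ENNReal.ofReal_rpow_of_nonneg (hf _) hp.le, ENNReal.ofReal_rpow_of_nonneg (hg _) hp.le]
  rw [← lintegral_count, ← lintegral_count,
    lintegral_rpow_eq_lintegral_meas_lt_mul _ (Eventually.of_forall hf)
      measurable_from_top.aemeasurable hp,
    lintegral_rpow_eq_lintegral_meas_lt_mul _ (Eventually.of_forall hg)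
      measurable_from_top.aemeasurable hp]
  congr 1
  refine setLIntegral_congr_fun measurableSet_Ioi fun t ht => ?_
  rw [Measure.count_apply MeasurableSpace.measurableSet_top,
    Measure.count_apply MeasurableSpace.measurableSet_top, h t (le_of_lt ht)]

variable {H : Type*} [NormedAddCommGroup H] [QuaternionicInnerProductSpace H]

theorem IsOrthonormal.comp {ι κ : Type*} {e : ι → H} (he : IsOrthonormal e) {f : κ → ι}
    (hf : Function.Injective f) : IsOrthonormal (e ∘ f) :=
  ⟨fun _ => he.1 _, fun _ _ h => he.2 _ _ fun h' => h (hf h')⟩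

theorem IsOrthonormal.enorm_eq_one {ι : Type*} {e : ι → H} (he : IsOrthonormal e) (k : ι) :
    ‖e k‖ₑ = 1 := by
  rw [← ofReal_norm, he.1, ENNReal.ofReal_one]

variable [CompleteSpace H]

/-- There are `m` orthonormal eigenvectors of `T* T` with eigenvalues `μ_k ^ 2`, `μ_k > t`. -/
def HasEigenvectorsAbove (T : H →L[ℍᵐᵒᵖ] H) (t : ℝ) (m : ℕ) : Prop :=
  ∃ (e : Fin m → H) (μ : Fin m → ℝ), IsOrthonormal e ∧
    ∀ k, t < μ k ∧ adjoint T (T (e k)) = MulOpposite.op ((μ k ^ 2 : ℝ) : ℍ) • e k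

theorem HasEigenvectorsAbove.mono {T : H →L[ℍᵐᵒᵖ] H} {t : ℝ} {m n : ℕ} (hmn : m ≤ n)
    (h : HasEigenvectorsAbove T t n) : HasEigenvectorsAbove T t m := by
  obtain ⟨e, μ, he, hμ⟩ := h
  exact ⟨e ∘ Fin.castLE hmn, μ ∘ Fin.castLE hmn, he.comp (Fin.castLE_injective hmn),
    fun k => hμ _⟩

theorem norm_apply_of_eigenvector {T : H →L[ℍᵐᵒᵖ] H} {x : H} {μ : ℝ} (hμ : 0 ≤ μ)
    (h : adjoint T (T x) = MulOpposite.op ((μ ^ 2 : ℝ) : ℍ) • x) : ‖T x‖ = μ * ‖x‖ := by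
  have h1 := inner_adjoint_apply_self T x
  rw [h, qinner_smul_right, qinner_self, ← Quaternion.coe_mul] at h1
  have h2 := Quaternion.coe_injective h1
  rw [← sq_eq_sq₀ (norm_nonneg _) (by positivity)]
  linarith [mul_pow μ ‖x‖ 2]

theorem singularValue_nonneg (T : H →L[ℍᵐᵒᵖ] H) (n : ℕ) : 0 ≤ singularValue T n :=
  Real.sSup_nonneg fun _ h => h.1

theorem lt_singularValue_iff (T : H →L[ℍᵐᵒᵖ] H) {t : ℝ} (ht : 0 ≤ t) (n : ℕ) :
    t < singularValue T n ↔ HasEigenvectorsAbove T t (n + 1) := by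
  constructor
  · intro h
    -- The supremum of the empty set is 0, so a supremum above `t ≥ 0` comes from a nonempty set.
    obtain ⟨s, ⟨-, e, μ, he, hμ⟩, hs⟩ := exists_lt_of_lt_csSup (by
      by_contra hne
      rw [singularValue, Set.not_nonempty_iff_eq_empty.1 hne, Real.sSup_empty] at h
      exact absurd h ht.not_gt) h
    exact ⟨e, μ, he, fun k => ⟨hs.trans_le (hμ k).1, (hμ k).2⟩⟩
  · rintro ⟨e, μ, he, hμ⟩
    obtain ⟨k, hk⟩ := Finite.exists_min μ
    refine (hμ k).1.trans_le (le_csSup ?_ ⟨ht.trans (hμ k).1.le, e, μ, he, fun l =>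
      ⟨hk l, (hμ l).2⟩⟩)
    obtain ⟨C, -, hC⟩ := exists_bound T
    refine ⟨C, ?_⟩
    rintro s ⟨hs0, e, μ, he, hμ⟩
    have h := hC (e 0)
    rw [norm_apply_of_eigenvector (hs0.trans (hμ 0).1) (hμ 0).2, he.1, mul_one, mul_one] at h
    exact (hμ 0).1.trans h

theorem natCast_le_encard_singularValue_iff (T : H →L[ℍᵐᵒᵖ] H) {t : ℝ} (ht : 0 ≤ t) (m : ℕ) :
    (m : ℕ∞) ≤ {n | t < singularValue T n}.encard ↔ HasEigenvectorsAbove T t m := by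
  simp only [lt_singularValue_iff T ht]
  constructor
  · intro h
    by_contra hm
    -- Index `n` stands for `n + 1` eigenvectors, so failure at `m` forces `n < m - 1`. The case `m
    -- = 0`, where the subtraction would truncate, is excluded by `hm0`.
    have hsub : {n | HasEigenvectorsAbove T t (n + 1)} ⊆ Set.Iio (m - 1) := by
      intro n hn
      by_contra h'
      exact hm (HasEigenvectorsAbove.mono (by simp at h'; omega) hn)
    have hm0 : m ≠ 0 := by
      rintro rfl
      exact hm ⟨Fin.elim0, Fin.elim0, ⟨fun k => k.elim0, fun k => k.elim0⟩, fun k => k.elim0⟩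
    have h1 := h.trans (Set.encard_le_encard hsub)
    rw [Set.encard_eq_coe_toFinset_card, Set.toFinset_Iio, Nat.card_Iio, Nat.cast_le] at h1
    omega
  · intro h
    have hsub : Set.Iio m ⊆ {n | HasEigenvectorsAbove T t (n + 1)} := fun n hn =>
      h.mono (Nat.succ_le_of_lt hn)
    refine le_trans (le_of_eq ?_) (Set.encard_le_encard hsub)
    rw [Set.encard_eq_coe_toFinset_card, Set.toFinset_Iio, Nat.card_Iio]

/-- Eigenvectors `e j` above level `t` are orthogonal to every `g k` with `μ k ≤ t`, as the
eigenvalues of `T* T` differ. Double counting `∑ |⟨g k, e j⟩| ^ 2` then bounds `m`: by Parseval each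
`j` contributes 1, and by Bessel each `k` at most 1. -/
theorem natCast_le_encard_eigenvalue_iff {T : H →L[ℍᵐᵒᵖ] H} {ι : Type*} {g : ι → H} {μ : ι → ℝ}
    (hg : IsOrthonormal g) (ht : IsTotal g) (hμ : ∀ k, 0 ≤ μ k)
    (hT : ∀ k, adjoint T (T (g k)) = MulOpposite.op ((μ k ^ 2 : ℝ) : ℍ) • g k)
    {t : ℝ} (ht0 : 0 ≤ t) (m : ℕ) :
    (m : ℕ∞) ≤ {k | t < μ k}.encard ↔ HasEigenvectorsAbove T t m := by
  constructor
  · intro h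
    obtain ⟨s, hs, hsm⟩ := Set.exists_subset_encard_eq h
    have hfin : s.Finite := Set.finite_of_encard_eq_coe hsm
    have : Fintype s := hfin.fintype
    have hcard : Fintype.card s = m := by
      rw [Set.encard_eq_coe_toFinset_card, Set.toFinset_card] at hsm
      exact_mod_cast hsm
    let f := (Fintype.equivFinOfCardEq hcard).symm
    exact ⟨fun j => g (f j), fun j => μ (f j),
      hg.comp (Subtype.val_injective.comp f.injective), fun j => ⟨hs (f j).2, hT _⟩⟩
  · rintro ⟨e, ν, he, hν⟩
    have hzero : ∀ j k, ¬ t < μ k → inner ℍ (g k) (e j) = 0 := by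
      intro j k hk
      have h1 : inner ℍ (g k) (adjoint T (T (e j))) = inner ℍ (adjoint T (T (g k))) (e j) := by
        rw [qadjoint_inner_right, qadjoint_inner_left]
      rw [(hν j).2, hT, qinner_smul_right, qinner_smul_left, Quaternion.star_coe,
        ← Quaternion.coe_commutes, ← sub_eq_zero, ← sub_mul, ← Quaternion.coe_sub] at h1
      refine (mul_eq_zero.1 h1).resolve_left fun h2 => ?_
      have h3 : ν j ^ 2 - μ k ^ 2 = 0 := Quaternion.coe_injective (by rw [h2, Quaternion.coe_zero])
      nlinarith [hμ k, (hν j).1]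
    have h1 : (m : ℝ≥0∞) ≤ ({k | t < μ k}.encard : ℝ≥0∞) :=
      calc (m : ℝ≥0∞) = ∑ j : Fin m, ∑' k, ‖inner ℍ (g k) (e j)‖ₑ ^ 2 := by
            simp [tsum_enorm_sq hg ht, he.enorm_eq_one]
        _ = ∑ j : Fin m, ∑' k : {k | t < μ k}, ‖inner ℍ (g k) (e j)‖ₑ ^ 2 := by
            refine Finset.sum_congr rfl fun j _ => ?_
            rw [tsum_subtype_eq_of_support_subset (s := {k | t < μ k})
              (f := fun k => ‖inner ℍ (g k) (e j)‖ₑ ^ 2)]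
            intro k hk
            by_contra h
            exact hk (by simp [hzero j k h])
        _ = ∑' k : {k | t < μ k}, ∑' j : Fin m, ‖inner ℍ (g k) (e j)‖ₑ ^ 2 := by
            rw [← tsum_fintype (L := .unconditional _), ENNReal.tsum_comm]
        _ ≤ ∑' k : {k | t < μ k}, 1 := by
            refine ENNReal.tsum_le_tsum fun k => ?_
            simp_rw [enorm_qinner_comm (g k)]
            refine (tsum_enorm_sq_le he _).trans ?_
            simp [hg.enorm_eq_one]
        _ = ({k | t < μ k}.encard : ℝ≥0∞) := by
            rw [ENNReal.tsum_set_one]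
    exact_mod_cast h1

theorem tsum_singularValue_rpow {T : H →L[ℍᵐᵒᵖ] H} {ι : Type*} {g : ι → H} {μ : ι → ℝ}
    (hg : IsOrthonormal g) (ht : IsTotal g) (hμ : ∀ k, 0 ≤ μ k)
    (hT : ∀ k, adjoint T (T (g k)) = MulOpposite.op ((μ k ^ 2 : ℝ) : ℍ) • g k)
    {p : ℝ} (hp : 0 < p) :
    ∑' n, ENNReal.ofReal (singularValue T n) ^ p = ∑' k, ENNReal.ofReal (μ k) ^ p := by
  refine tsum_ofReal_rpow_eq_of_encard_eq (singularValue_nonneg T) hμ (fun t ht0 => ?_) hp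
  refine ENat.eq_of_forall_natCast_le_iff fun m => ?_
  rw [natCast_le_encard_singularValue_iff T ht0, natCast_le_encard_eigenvalue_iff hg ht hμ hT ht0]

end Counting

/-! ### Jensen and power inequalities in `[0, ∞]`. -/

section Inequalities

variable {ι : Type*}

theorem ennreal_two_mul_le_add_sq (a b : ℝ≥0∞) : 2 * (a * b) ≤ a ^ 2 + b ^ 2 := by
  wlog h : a ≤ b generalizing a b
  · rw [mul_comm a b, add_comm]
    exact this b a (le_of_not_ge h)
  obtain ⟨c, rfl⟩ := exists_add_of_le h
  calc 2 * (a * (a + c)) ≤ 2 * (a * (a + c)) + c ^ 2 := le_self_add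
    _ = a ^ 2 + (a + c) ^ 2 := by ring

/-- Makes products of Bessel coefficients of two families into subprobability weights. -/
theorem tsum_mul_le_one {a b : ι → ℝ≥0∞} (ha : ∑' k, a k ^ 2 ≤ 1) (hb : ∑' k, b k ^ 2 ≤ 1) :
    ∑' k, a k * b k ≤ 1 := by
  have h : 2 * ∑' k, a k * b k ≤ 2 * 1 := by
    rw [← ENNReal.tsum_mul_left]
    refine (ENNReal.tsum_le_tsum fun k => ennreal_two_mul_le_add_sq (a k) (b k)).trans ?_
    rw [ENNReal.tsum_add]
    exact (add_le_add ha hb).trans_eq (by norm_num)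
  exact (ENNReal.mul_le_mul_iff_right two_ne_zero ENNReal.ofNat_ne_top).1 h

/-- Jensen's inequality for a convex power and a subprobability weight. -/
theorem rpow_tsum_mul_le {w x : ι → ℝ≥0∞} (hw : ∑' k, w k ≤ 1) {q : ℝ} (hq : 1 ≤ q) :
    (∑' k, w k * x k) ^ q ≤ ∑' k, w k * x k ^ q := by
  have hq0 : 0 < q := one_pos.trans_le hq
  have h : ∑' k, w k * x k ≤ (∑' k, w k * x k ^ q) ^ q⁻¹ := by
    rw [ENNReal.tsum_eq_iSup_sum]
    refine iSup_le fun s => (ENNReal.inner_le_weight_mul_Lp_of_nonneg s hq w x).trans ?_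
    calc (∑ k ∈ s, w k) ^ (1 - q⁻¹) * (∑ k ∈ s, w k * x k ^ q) ^ q⁻¹
        ≤ 1 * (∑' k, w k * x k ^ q) ^ q⁻¹ := by
          refine mul_le_mul' (ENNReal.rpow_le_one ((ENNReal.sum_le_tsum s).trans hw) ?_)
            (ENNReal.rpow_le_rpow (ENNReal.sum_le_tsum s) (by positivity))
          rw [sub_nonneg]
          exact inv_le_one_of_one_le₀ hq
      _ = _ := one_mul _
  calc _ ≤ ((∑' k, w k * x k ^ q) ^ q⁻¹) ^ q := ENNReal.rpow_le_rpow h hq0.le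
    _ = _ := by rw [← ENNReal.rpow_mul, inv_mul_cancel₀ hq0.ne', ENNReal.rpow_one]

/-- Jensen's inequality for a concave power and a subprobability weight. -/
theorem tsum_mul_rpow_le {w x : ι → ℝ≥0∞} (hw : ∑' k, w k ≤ 1) {q : ℝ} (hq0 : 0 < q)
    (hq : q ≤ 1) : ∑' k, w k * x k ^ q ≤ (∑' k, w k * x k) ^ q := by
  have h := rpow_tsum_mul_le (x := fun k => x k ^ q) hw ((one_le_inv₀ hq0).2 hq)
  simp_rw [← ENNReal.rpow_mul, mul_inv_cancel₀ hq0.ne', ENNReal.rpow_one] at h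
  calc _ = ((∑' k, w k * x k ^ q) ^ q⁻¹) ^ q := by
        rw [← ENNReal.rpow_mul, inv_mul_cancel₀ hq0.ne', ENNReal.rpow_one]
    _ ≤ _ := ENNReal.rpow_le_rpow h hq0.le

theorem rpow_tsum_le_tsum_rpow (x : ι → ℝ≥0∞) {q : ℝ} (hq0 : 0 < q) (hq : q ≤ 1) :
    (∑' k, x k) ^ q ≤ ∑' k, x k ^ q := by
  have hfin : ∀ s : Finset ι, (∑ k ∈ s, x k) ^ q ≤ ∑ k ∈ s, x k ^ q := by
    classical
    intro s
    induction s using Finset.induction_on with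
    | empty => simp [hq0]
    | insert a s ha ih =>
      rw [Finset.sum_insert ha, Finset.sum_insert ha]
      exact (ENNReal.rpow_add_le_add_rpow _ _ hq0.le hq).trans (add_le_add le_rfl ih)
  have h : ∑' k, x k ≤ (∑' k, x k ^ q) ^ q⁻¹ := by
    rw [ENNReal.tsum_eq_iSup_sum]
    exact iSup_le fun s => (ENNReal.le_rpow_inv_iff hq0).2
      ((hfin s).trans (ENNReal.sum_le_tsum s))
  exact (ENNReal.le_rpow_inv_iff hq0).1 h

theorem ennreal_sq_rpow_half (a : ℝ≥0∞) (p : ℝ) : (a ^ 2) ^ (p / 2) = a ^ p := by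
  rw [← ENNReal.rpow_natCast, ← ENNReal.rpow_mul]
  congr 1
  push_cast
  ring

end Inequalities

/-! ### Sums over orthonormal families compared with singular values. -/

section SingularBasis

variable {H : Type*} [NormedAddCommGroup H] [QuaternionicInnerProductSpace H]

theorem IsOrthonormalIn.comp {J : H →L[ℍᵐᵒᵖ] H} {i : ℍ} {ι κ : Type*} {e : ι → H}
    (he : IsOrthonormalIn J i e) {f : κ → ι} (hf : Function.Injective f) :
    IsOrthonormalIn J i (e ∘ f) :=
  ⟨he.1.comp hf, fun k => he.2 (f k)⟩

variable [CompleteSpace H]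

/-- `g` is a total orthonormal family of eigenvectors of `T* T` with eigenvalues `μ_k ^ 2`. -/
structure IsSingularBasis (T : H →L[ℍᵐᵒᵖ] H) {ι : Type*} (g : ι → H) (μ : ι → ℝ) : Prop where
  orthonormal : IsOrthonormal g
  total : IsTotal g
  nonneg : ∀ k, 0 ≤ μ k
  eigen : ∀ k, adjoint T (T (g k)) = MulOpposite.op ((μ k ^ 2 : ℝ) : ℍ) • g k

theorem adjoint_comm {J T : H →L[ℍᵐᵒᵖ] H} (hJ : IsAntiSelfAdjointUnitary J) (h : T * J = J * T) :
    adjoint T * J = J * adjoint T := by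
  have h1 := congrArg adjoint h
  rw [adjoint_mul, adjoint_mul, hJ.1] at h1
  ext x
  have h2 : -J (adjoint T x) = adjoint T (-J x) :=
    congrArg (fun S : H →L[ℍᵐᵒᵖ] H => S x) h1
  rw [map_neg, neg_inj] at h2
  exact h2.symm

theorem exists_singularBasis [TopologicalSpace.SeparableSpace H] {J : H →L[ℍᵐᵒᵖ] H}
    (hJ : IsAntiSelfAdjointUnitary J) {i : ℍ} (hi : i.re = 0) (hn : ‖i‖ = 1)
    {T : H →L[ℍᵐᵒᵖ] H} (hT : IsCompactOperator T) (hTJ : T * J = J * T) :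
    ∃ (S : Set H) (μ : S → ℝ), S.Countable ∧ IsOrthonormalIn J i (Subtype.val : S → H) ∧
      IsSingularBasis T (Subtype.val : S → H) μ := by
  obtain ⟨S, r, hS, horth, htot, hr⟩ := exists_eigenbasis hJ hi hn
    (isCompactOperator_adjoint_mul_self hT) (by rw [adjoint_mul, adjoint_adjoint])
    (by rw [mul_assoc, hTJ, ← mul_assoc, adjoint_comm hJ hTJ, mul_assoc])
  have hr' : ∀ k, r k = ‖T k‖ ^ 2 := by
    intro k
    have h := inner_adjoint_apply_self T k
    have h1 : adjoint T (T k) = MulOpposite.op (r k : ℍ) • (k : H) := hr k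
    rw [h1, qinner_smul_right, qinner_self, horth.1.1, one_pow, Quaternion.coe_one, one_mul] at h
    exact Quaternion.coe_injective h
  refine ⟨S, fun k => ‖T k‖, hS, horth, horth.1, htot, fun _ => norm_nonneg _, fun k => ?_⟩
  rw [← hr']
  exact hr k

/-- Eigenvectors of `A` itself, with eigenvalues `r k`, form a singular basis with `μ k = |r k|`; on
it the diagonal of `A` already shows the singular values. -/
theorem exists_selfAdjoint_singularBasis [TopologicalSpace.SeparableSpace H] {J : H →L[ℍᵐᵒᵖ] H}
    (hJ : IsAntiSelfAdjointUnitary J) {i : ℍ} (hi : i.re = 0) (hn : ‖i‖ = 1)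
    {A : H →L[ℍᵐᵒᵖ] H} (hA : IsCompactOperator A) (hs : adjoint A = A) (hAJ : A * J = J * A) :
    ∃ (S : Set H) (μ : S → ℝ), S.Countable ∧ IsOrthonormalIn J i (Subtype.val : S → H) ∧
      IsSingularBasis A (Subtype.val : S → H) μ ∧ ∀ k : S, ‖inner ℍ (k : H) (A k)‖ = μ k := by
  obtain ⟨S, r, hS, horth, htot, hr⟩ := exists_eigenbasis hJ hi hn hA hs hAJ
  refine ⟨S, fun k => |r k|, hS, horth, ⟨horth.1, htot, fun _ => abs_nonneg _, fun k => ?_⟩,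
    fun k => ?_⟩
  · rw [hs, hr, map_smul, hr, op_coe_smul_smul, sq_abs, sq]
  · rw [hr, qinner_smul_right, qinner_self, horth.1.1, one_pow, Quaternion.coe_one, one_mul,
      Quaternion.norm_coe, Real.norm_eq_abs]

namespace IsSingularBasis

variable {T : H →L[ℍᵐᵒᵖ] H} {ι κ : Type*} {g : ι → H} {μ : ι → ℝ}

theorem norm_apply (hg : IsSingularBasis T g μ) (k : ι) : ‖T (g k)‖ = μ k := by
  rw [norm_apply_of_eigenvector (hg.nonneg k) (hg.eigen k), hg.orthonormal.1, mul_one]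

theorem enorm_apply (hg : IsSingularBasis T g μ) (k : ι) : ‖T (g k)‖ₑ = ENNReal.ofReal (μ k) := by
  rw [← ofReal_norm, hg.norm_apply]

theorem enorm_apply_sq (hg : IsSingularBasis T g μ) (x : H) :
    ‖T x‖ₑ ^ 2 = ∑' k, ‖inner ℍ (g k) x‖ₑ ^ 2 * ENNReal.ofReal (μ k) ^ 2 := by
  have h := hasSum_qinner_mul hg.orthonormal hg.total (adjoint T (T x)) x
  rw [qadjoint_inner_left, qinner_self] at h
  have h1 : HasSum (fun k => ‖inner ℍ (g k) x‖ ^ 2 * μ k ^ 2) (‖T x‖ ^ 2) := by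
    refine Quaternion.hasSum_coe.1 ?_
    convert h using 2 with k
    rw [qadjoint_inner_left, ← qadjoint_inner_right, hg.eigen, qinner_smul_right, mul_assoc,
      Quaternion.coe_commutes, ← mul_assoc, ← star_qinner (g k) x, star_mul_self_eq_norm_sq,
      Quaternion.coe_mul]
  have h2 : ∀ k, ‖inner ℍ (g k) x‖ₑ ^ 2 * ENNReal.ofReal (μ k) ^ 2 =
      ENNReal.ofReal (‖inner ℍ (g k) x‖ ^ 2 * μ k ^ 2) := fun k => by
    rw [ENNReal.ofReal_mul (by positivity), ENNReal.ofReal_pow (norm_nonneg _),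
      ENNReal.ofReal_pow (hg.nonneg k), ofReal_norm]
  simp_rw [h2]
  rw [← ENNReal.ofReal_tsum_of_nonneg (fun _ => by positivity) h1.summable, h1.tsum_eq,
    ENNReal.ofReal_pow (norm_nonneg _), ofReal_norm]

theorem tsum_weight_le_one (hg : IsSingularBasis T g μ) {x : H} (hx : ‖x‖ₑ = 1) :
    ∑' k, ‖inner ℍ (g k) x‖ₑ ^ 2 ≤ 1 := by
  simpa [hx] using tsum_enorm_sq_le hg.orthonormal x

/-- Jensen for the convex power `p / 2` and the weights `|⟨g k, e n⟩| ^ 2` in `k`, then Bessel in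
`n`. -/
theorem tsum_enorm_apply_rpow_le (hg : IsSingularBasis T g μ) {e : κ → H} (he : IsOrthonormal e)
    {p : ℝ} (hp : 2 ≤ p) : ∑' n, ‖T (e n)‖ₑ ^ p ≤ ∑' k, ENNReal.ofReal (μ k) ^ p :=
  calc ∑' n, ‖T (e n)‖ₑ ^ p
      ≤ ∑' n, ∑' k, ‖inner ℍ (g k) (e n)‖ₑ ^ 2 * ENNReal.ofReal (μ k) ^ p := by
        refine ENNReal.tsum_le_tsum fun n => ?_
        rw [← ennreal_sq_rpow_half, hg.enorm_apply_sq]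
        refine (rpow_tsum_mul_le (hg.tsum_weight_le_one (he.enorm_eq_one n))
          (by linarith : 1 ≤ p / 2)).trans_eq ?_
        simp_rw [ennreal_sq_rpow_half]
    _ = ∑' k, (∑' n, ‖inner ℍ (e n) (g k)‖ₑ ^ 2) * ENNReal.ofReal (μ k) ^ p := by
        rw [ENNReal.tsum_comm]
        simp_rw [ENNReal.tsum_mul_right, enorm_qinner_comm (e _)]
    _ ≤ ∑' k, ENNReal.ofReal (μ k) ^ p := ENNReal.tsum_le_tsum fun k =>
        mul_le_of_le_one_left' (by
          simpa [hg.orthonormal.enorm_eq_one] using tsum_enorm_sq_le he (g k))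

/-- The same weights with a concave power. Totality of `e` makes their sum over `n` exactly 1. -/
theorem tsum_rpow_le (hg : IsSingularBasis T g μ) {e : κ → H} (he : IsOrthonormal e)
    (ht : IsTotal e) {p : ℝ} (hp0 : 0 < p) (hp : p ≤ 2) :
    ∑' k, ENNReal.ofReal (μ k) ^ p ≤ ∑' n, ‖T (e n)‖ₑ ^ p :=
  calc ∑' k, ENNReal.ofReal (μ k) ^ p
      = ∑' k, (∑' n, ‖inner ℍ (e n) (g k)‖ₑ ^ 2) * ENNReal.ofReal (μ k) ^ p := by
        simp_rw [tsum_enorm_sq he ht, hg.orthonormal.enorm_eq_one, one_pow, one_mul]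
    _ = ∑' n, ∑' k, ‖inner ℍ (g k) (e n)‖ₑ ^ 2 * ENNReal.ofReal (μ k) ^ p := by
        rw [ENNReal.tsum_comm]
        simp_rw [ENNReal.tsum_mul_right, enorm_qinner_comm (e _)]
    _ ≤ ∑' n, ‖T (e n)‖ₑ ^ p := by
        refine ENNReal.tsum_le_tsum fun n => ?_
        rw [← ennreal_sq_rpow_half, hg.enorm_apply_sq]
        refine le_trans (le_of_eq ?_) (tsum_mul_rpow_le
          (hg.tsum_weight_le_one (he.enorm_eq_one n)) (by positivity : 0 < p / 2) (by linarith))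
        simp_rw [ennreal_sq_rpow_half]

/-- The images of the members of a singular basis with nonzero singular value, normalized. -/
noncomputable def image (_ : IsSingularBasis T g μ) (k : {k | μ k ≠ 0}) : H :=
  MulOpposite.op (((μ k)⁻¹ : ℝ) : ℍ) • T (g k)

theorem inner_apply_apply (hg : IsSingularBasis T g μ) (k l : ι) :
    inner ℍ (T (g k)) (T (g l)) = ((μ k ^ 2 : ℝ) : ℍ) * inner ℍ (g k) (g l) := by
  rw [← qadjoint_inner_left, hg.eigen, qinner_smul_left, Quaternion.star_coe]

theorem orthonormal_image (hg : IsSingularBasis T g μ) : IsOrthonormal hg.image := by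
  refine ⟨fun k => ?_, fun k l h => ?_⟩
  · rw [image, norm_op_smul, hg.norm_apply, Quaternion.norm_coe, norm_inv,
      Real.norm_of_nonneg (hg.nonneg k), inv_mul_cancel₀ k.2]
  · rw [image, image, qinner_smul_left, qinner_smul_right, hg.inner_apply_apply,
      hg.orthonormal.2 k l fun h' => h (Subtype.ext h')]
    simp

theorem apply_eq_image (hg : IsSingularBasis T g μ) (k : {k | μ k ≠ 0}) :
    T (g k) = MulOpposite.op (μ k : ℍ) • hg.image k := by
  rw [image, op_coe_smul_smul, mul_inv_cancel₀ k.2, op_coe_one_smul]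

theorem enorm_inner_image (hg : IsSingularBasis T g μ) (k : {k | μ k ≠ 0}) :
    ‖inner ℍ (hg.image k) (T (g k))‖ₑ = ENNReal.ofReal (μ k) := by
  rw [hg.apply_eq_image, qinner_smul_right, qinner_self, hg.orthonormal_image.1, one_pow,
    Quaternion.coe_one, one_mul, ← ofReal_norm, Quaternion.norm_coe,
    Real.norm_of_nonneg (hg.nonneg k)]

theorem tsum_enorm_inner_image (hg : IsSingularBasis T g μ) {p : ℝ} (hp : 0 < p) :
    ∑' k : {k | μ k ≠ 0}, ‖inner ℍ (hg.image k) (T (g k))‖ₑ ^ p =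
      ∑' k, ENNReal.ofReal (μ k) ^ p := by
  simp_rw [hg.enorm_inner_image]
  refine tsum_subtype_eq_of_support_subset (f := fun k => ENNReal.ofReal (μ k) ^ p) fun k hk h => ?_
  exact hk (by simp [h, hp])

/-- The singular value expansion of `⟨x, T y⟩`; indices with `μ k = 0` drop out because there `T (g
k) = 0`. -/
theorem enorm_inner_apply_le (hg : IsSingularBasis T g μ) (x y : H) :
    ‖inner ℍ x (T y)‖ₑ ≤ ∑' k : {k | μ k ≠ 0},
      ‖inner ℍ (hg.image k) x‖ₑ * ‖inner ℍ (g k) y‖ₑ * ENNReal.ofReal (μ k) := by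
  rw [← qadjoint_inner_left]
  refine (enorm_qinner_le_tsum hg.orthonormal hg.total _ _).trans_eq ?_
  rw [← tsum_subtype_eq_of_support_subset (s := {k | μ k ≠ 0})]
  · refine tsum_congr fun k => ?_
    rw [qadjoint_inner_left, hg.apply_eq_image, qinner_smul_right, enorm_mul,
      enorm_qinner_comm x, ← ofReal_norm (μ k : ℍ), Quaternion.norm_coe,
      Real.norm_of_nonneg (hg.nonneg k), mul_right_comm]
  · intro k hk h
    have h0 : T (g k) = 0 := norm_eq_zero.1 ((hg.norm_apply k).trans h)
    exact hk (by simp [qadjoint_inner_left, h0])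

/-- The weights `|⟨h_k, σ n⟩| |⟨g k, e n⟩|`, with `h_k` the normalized image of `g k`, sum to at
most 1 over `k` and over `n`: Jensen uses the first, the exchanged sum the second. -/
theorem tsum_enorm_inner_rpow_le (hg : IsSingularBasis T g μ) {e σ : κ → H}
    (he : IsOrthonormal e) (hσ : IsOrthonormal σ) {p : ℝ} (hp : 1 ≤ p) :
    ∑' n, ‖inner ℍ (σ n) (T (e n))‖ₑ ^ p ≤ ∑' k, ENNReal.ofReal (μ k) ^ p := by
  have hK : IsOrthonormal fun k : {k | μ k ≠ 0} => g k :=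
    hg.orthonormal.comp Subtype.val_injective
  calc ∑' n, ‖inner ℍ (σ n) (T (e n))‖ₑ ^ p
      ≤ ∑' n, ∑' k : {k | μ k ≠ 0}, ‖inner ℍ (hg.image k) (σ n)‖ₑ * ‖inner ℍ (g k) (e n)‖ₑ *
          ENNReal.ofReal (μ k) ^ p := by
        refine ENNReal.tsum_le_tsum fun n => (ENNReal.rpow_le_rpow
          (hg.enorm_inner_apply_le _ _) (by linarith)).trans
            (rpow_tsum_mul_le (tsum_mul_le_one ?_ ?_) hp)
        · simpa [hσ.enorm_eq_one] using tsum_enorm_sq_le hg.orthonormal_image (σ n)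
        · simpa [he.enorm_eq_one] using tsum_enorm_sq_le hK (e n)
    _ = ∑' k : {k | μ k ≠ 0}, (∑' n, ‖inner ℍ (σ n) (hg.image k)‖ₑ * ‖inner ℍ (e n) (g k)‖ₑ) *
          ENNReal.ofReal (μ k) ^ p := by
        rw [ENNReal.tsum_comm]
        simp_rw [ENNReal.tsum_mul_right, enorm_qinner_comm (e _), enorm_qinner_comm (σ _)]
    _ ≤ ∑' k : {k | μ k ≠ 0}, ENNReal.ofReal (μ k) ^ p := by
        refine ENNReal.tsum_le_tsum fun k => mul_le_of_le_one_left' (tsum_mul_le_one ?_ ?_)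
        · simpa [hg.orthonormal_image.enorm_eq_one] using tsum_enorm_sq_le hσ (hg.image k)
        · simpa [hg.orthonormal.enorm_eq_one] using tsum_enorm_sq_le he (g k)
    _ ≤ ∑' k, ENNReal.ofReal (μ k) ^ p :=
        ENNReal.tsum_comp_le_tsum_of_injective Subtype.val_injective
          fun k => ENNReal.ofReal (μ k) ^ p

theorem tsum_singularValue (hg : IsSingularBasis T g μ) {p : ℝ} (hp : 0 < p) :
    ∑' n, ENNReal.ofReal (singularValue T n) ^ p = ∑' k, ENNReal.ofReal (μ k) ^ p :=
  tsum_singularValue_rpow hg.orthonormal hg.total hg.nonneg hg.eigen hp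

end IsSingularBasis

theorem mem_schattenClass_iff {J T : H →L[ℍᵐᵒᵖ] H} (hT : IsCompactOperator T)
    (hTJ : T * J = J * T) {p : ℝ} (hp : 0 < p) :
    T ∈ schattenClass J p ↔ ∑' n, ENNReal.ofReal (singularValue T n) ^ p < ∞ := by
  have h : T ∈ schattenClass J p ↔ Summable fun n => singularValue T n ^ p :=
    ⟨fun h => h.2.2, fun h => ⟨hT, hTJ, h⟩⟩
  have h0 : ∀ n, 0 ≤ singularValue T n ^ p := fun n =>
    Real.rpow_nonneg (singularValue_nonneg T n) p
  simp_rw [h, ENNReal.ofReal_rpow_of_nonneg (singularValue_nonneg T _) hp.le, lt_top_iff_ne_top]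
  refine ⟨fun hs => hs.tsum_ofReal_ne_top, fun hs => ?_⟩
  simpa [ENNReal.toReal_ofReal (h0 _)] using ENNReal.summable_toReal hs

/-- Transports countable eigenbases to the index sets `I ⊆ ℕ` of the theorem. -/
theorem exists_natSet_equiv (ι : Type*) [Countable ι] : ∃ I : Set ℕ, Nonempty (I ≃ ι) := by
  obtain ⟨f, hf⟩ := exists_injective_nat ι
  exact ⟨Set.range f, ⟨(Equiv.ofInjective f hf).symm⟩⟩

end SingularBasis

/-! ### From summable diagonals to summable singular values. -/

section Converse

variable {H : Type*} [NormedAddCommGroup H] [QuaternionicInnerProductSpace H] [CompleteSpace H]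

theorem IsOrthonormalIn.image {J T : H →L[ℍᵐᵒᵖ] H} {i : ℍ} (hTJ : T * J = J * T) {ι : Type*}
    {g : ι → H} {μ : ι → ℝ} (hg : IsSingularBasis T g μ) (hgi : IsOrthonormalIn J i g) :
    IsOrthonormalIn J i hg.image :=
  ⟨hg.orthonormal_image, fun k => op_coe_smul_mem_HPlus (apply_mem_HPlus hTJ (hgi.2 k)) _⟩

/-- Moved to the left, `J` acts on `x` as the unit scalar `i`. -/
theorem norm_inner_J {J : H →L[ℍᵐᵒᵖ] H} (hJ : IsAntiSelfAdjointUnitary J) {i : ℍ} (hn : ‖i‖ = 1)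
    {x : H} (hx : x ∈ HPlus J i) (y : H) : ‖inner ℍ x (J y)‖ = ‖inner ℍ x y‖ := by
  have hx' : J x = MulOpposite.op i • x := hx
  rw [← norm_neg, ← qinner_J_left hJ, hx', qinner_smul_left, norm_mul, Quaternion.norm_star, hn,
    one_mul]

theorem schattenNorm_eq {T : H →L[ℍᵐᵒᵖ] H} {ι : Type*} {g : ι → H} {μ : ι → ℝ}
    (hg : IsSingularBasis T g μ) {p : ℝ} (hp : 0 < p) :
    schattenNorm p T = (∑' k, ENNReal.ofReal (μ k) ^ p) ^ (1 / p) := by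
  rw [schattenNorm, hg.tsum_singularValue hp]

variable [TopologicalSpace.SeparableSpace H] {J : H →L[ℍᵐᵒᵖ] H}

/-- A selfadjoint operator whose diagonal entries are dominated by those of `T` has summable
singular values if all diagonals of `T` are summable. -/
theorem tsum_singularValue_lt_top_of_diagonal (hJ : IsAntiSelfAdjointUnitary J) {i : ℍ}
    (hi : i.re = 0) (hn : ‖i‖ = 1) {T A : H →L[ℍᵐᵒᵖ] H} {p : ℝ} (hp : 0 < p)
    (hd : ∀ (I : Set ℕ) (e : I → H), IsOrthonormalIn J i e →
      ∑' n, ‖inner ℍ (e n) (T (e n))‖ₑ ^ p < ∞)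
    (hA : IsCompactOperator A) (hs : adjoint A = A) (hAJ : A * J = J * A)
    (hAT : ∀ x ∈ HPlus J i, ‖inner ℍ x (A x)‖ ≤ 2 * ‖inner ℍ x (T x)‖) :
    ∑' n, ENNReal.ofReal (singularValue A n) ^ p < ∞ := by
  -- The eigenbasis of `A` lies in `H₊`, so it is an admissible test family for the diagonal of `T`.
  obtain ⟨S, μ, hS, horth, hg, hμ⟩ := exists_selfAdjoint_singularBasis hJ hi hn hA hs hAJ
  have := hS.to_subtype
  obtain ⟨I, ⟨φ⟩⟩ := exists_natSet_equiv S
  rw [hg.tsum_singularValue hp]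
  calc ∑' k, ENNReal.ofReal (μ k) ^ p
      ≤ ∑' k : S, 2 ^ p * ‖inner ℍ (k : H) (T k)‖ₑ ^ p := by
        refine ENNReal.tsum_le_tsum fun k => ?_
        rw [← ENNReal.mul_rpow_of_nonneg _ _ hp.le, ← hμ, ← ofReal_norm,
          ← ENNReal.ofReal_ofNat 2, ← ENNReal.ofReal_mul (by norm_num)]
        exact ENNReal.rpow_le_rpow (ENNReal.ofReal_le_ofReal (hAT k (horth.2 k))) hp.le
    _ = 2 ^ p * ∑' n : I, ‖inner ℍ (φ n : H) (T (φ n))‖ₑ ^ p := by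
        rw [ENNReal.tsum_mul_left, ← φ.tsum_eq]
    _ < ∞ := ENNReal.mul_lt_top (ENNReal.rpow_lt_top_of_nonneg hp.le ENNReal.ofNat_ne_top)
        (hd I _ (horth.comp φ.injective))

theorem tsum_enorm_inner_rpow_le (hJ : IsAntiSelfAdjointUnitary J) {i : ℍ} (hi : i.re = 0)
    (hn : ‖i‖ = 1) {T : H →L[ℍᵐᵒᵖ] H} (hT : IsCompactOperator T) (hTJ : T * J = J * T)
    {κ : Type*} {e σ : κ → H} (he : IsOrthonormal e) (hσ : IsOrthonormal σ) {p : ℝ} (hp : 1 ≤ p) :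
    ∑' n, ‖inner ℍ (σ n) (T (e n))‖ₑ ^ p ≤ ∑' n, ENNReal.ofReal (singularValue T n) ^ p := by
  obtain ⟨S, μ, -, -, hg⟩ := exists_singularBasis hJ hi hn hT hTJ
  rw [hg.tsum_singularValue (one_pos.trans_le hp)]
  exact hg.tsum_enorm_inner_rpow_le he hσ hp

/-- `T + T*` and `J (T - T*)` replace the real and imaginary parts of `T`, with `J` as imaginary
unit. Comparing entries at the singular pairs of `T` avoids a triangle inequality for
`schattenNorm`. -/
theorem tsum_singularValue_lt_top_of_forall_diagonal (hJ : IsAntiSelfAdjointUnitary J) {i : ℍ}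
    (hi : i.re = 0) (hn : ‖i‖ = 1) {T : H →L[ℍᵐᵒᵖ] H} (hT : IsCompactOperator T)
    (hTJ : T * J = J * T) {p : ℝ} (hp : 1 ≤ p)
    (hd : ∀ (I : Set ℕ) (e : I → H), IsOrthonormalIn J i e →
      ∑' n, ‖inner ℍ (e n) (T (e n))‖ₑ ^ p < ∞) :
    ∑' n, ENNReal.ofReal (singularValue T n) ^ p < ∞ := by
  have hp0 : 0 < p := one_pos.trans_le hp
  have hTJ' : ∀ x, T (J x) = J (T x) := fun x =>
    congrArg (fun S : H →L[ℍᵐᵒᵖ] H => S x) hTJ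
  have hTaJ : ∀ x, adjoint T (J x) = J (adjoint T x) := fun x =>
    congrArg (fun S : H →L[ℍᵐᵒᵖ] H => S x) (adjoint_comm hJ hTJ)
  have hTa := isCompactOperator_adjoint hT
  have hnorm : ∀ x, ‖inner ℍ x (adjoint T x)‖ = ‖inner ℍ x (T x)‖ := fun x => by
    rw [qadjoint_inner_right, norm_qinner_comm]
  have hAc : IsCompactOperator (T + adjoint T : H →L[ℍᵐᵒᵖ] H) := hT.add hTa
  have hAJ : (T + adjoint T) * J = J * (T + adjoint T) := by
    ext x
    change T (J x) + adjoint T (J x) = J (T x + adjoint T x)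
    rw [hTJ', hTaJ, map_add]
  have hBc : IsCompactOperator (J * (T - adjoint T) : H →L[ℍᵐᵒᵖ] H) := (hT.sub hTa).clm_comp J
  have hBJ : J * (T - adjoint T) * J = J * (J * (T - adjoint T)) := by
    ext x
    change J (T (J x) - adjoint T (J x)) = J (J (T x - adjoint T x))
    rw [hTJ', hTaJ, map_sub J (T x)]
  have hA := tsum_singularValue_lt_top_of_diagonal hJ hi hn hp0 hd hAc
    (by rw [adjoint_add, adjoint_adjoint, add_comm]) hAJ (fun x _ => by
      rw [add_apply, qinner_add_right]
      refine (norm_add_le _ _).trans_eq ?_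
      rw [hnorm, two_mul])
  have hB := tsum_singularValue_lt_top_of_diagonal hJ hi hn hp0 hd hBc
    (by
      rw [adjoint_mul, adjoint_sub, adjoint_adjoint, hJ.1]
      ext x
      change adjoint T (-J x) - T (-J x) = J (T x - adjoint T x)
      rw [map_neg, map_neg, hTJ', hTaJ, map_sub]
      abel) hBJ (fun x hx => by
      rw [mul_apply_eq_comp, norm_inner_J hJ hn hx, sub_apply, qinner_sub_right]
      refine (norm_sub_le _ _).trans_eq ?_
      rw [hnorm, two_mul])
  obtain ⟨S, μ, -, horth, hg⟩ := exists_singularBasis hJ hi hn hT hTJ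
  rw [hg.tsum_singularValue hp0, ← hg.tsum_enorm_inner_image hp0]
  have hσ := horth.image hTJ hg
  have he : IsOrthonormalIn J i fun k : {k | μ k ≠ 0} => ((k : S) : H) :=
    horth.comp Subtype.val_injective
  -- From `2 a = (a + b) + (a - b)` for the entries `a` of `T` and `b` of `T*`, together with `(x +
  -- y) ^ p ≤ 2 ^ (p - 1) (x ^ p + y ^ p)`.
  have hle : ∀ k : {k | μ k ≠ 0}, ‖inner ℍ (hg.image k) (T (k : S))‖ₑ ^ p ≤
      2 ^ (p - 1) * (‖inner ℍ (hg.image k) ((T + adjoint T) (k : S))‖ₑ ^ p +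
        ‖inner ℍ (hg.image k) ((J * (T - adjoint T)) (k : S))‖ₑ ^ p) := by
    intro k
    refine le_trans (ENNReal.rpow_le_rpow ?_ hp0.le)
      (ENNReal.rpow_add_le_mul_rpow_add_rpow _ _ hp)
    rw [← ofReal_norm, ← ofReal_norm, ← ofReal_norm,
      ← ENNReal.ofReal_add (norm_nonneg _) (norm_nonneg _)]
    refine ENNReal.ofReal_le_ofReal ?_
    rw [mul_apply_eq_comp, norm_inner_J hJ hn (hσ.2 k), add_apply, sub_apply, qinner_add_right,
      qinner_sub_right]
    set a := inner ℍ (hg.image k) (T (k : S))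
    set b := inner ℍ (hg.image k) (adjoint T (k : S))
    have h1 : ‖a + a‖ ≤ ‖a + b‖ + ‖a - b‖ := by
      refine le_trans (le_of_eq ?_) (norm_add_le _ _)
      congr 1
      abel
    rw [← two_smul ℝ a, norm_smul, Real.norm_ofNat] at h1
    linarith [norm_nonneg a]
  refine (ENNReal.tsum_le_tsum hle).trans_lt ?_
  rw [ENNReal.tsum_mul_left, ENNReal.tsum_add]
  refine ENNReal.mul_lt_top (ENNReal.rpow_lt_top_of_nonneg (by linarith) ENNReal.ofNat_ne_top)
    (ENNReal.add_lt_top.2 ⟨?_, ?_⟩)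
  · exact (tsum_enorm_inner_rpow_le hJ hi hn hAc hAJ he.1 hσ.1 hp).trans_lt hA
  · exact (tsum_enorm_inner_rpow_le hJ hi hn hBc hBJ he.1 hσ.1 hp).trans_lt hB

end Converse

end QuatSchatten

/-! ### The four statements of the theorem. -/

theorem mainTheorem10 {H : Type*} [NormedAddCommGroup H] [QuaternionicInnerProductSpace H]
    [CompleteSpace H] [TopologicalSpace.SeparableSpace H]
    (J : H →L[ℍᵐᵒᵖ] H) (hJ : IsAntiSelfAdjointUnitary J) (i : ℍ) (hi_re : i.re = 0) (hi_norm : ‖i‖ = 1)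
    (T : H →L[ℍᵐᵒᵖ] H) (hT : IsCompactOperator T) (hTJ : T * J = J * T) :
    -- the sums of `‖T e_n‖ ^ p`, for `p ≥ 2`
    (∀ p : ℝ, 2 ≤ p →
      (T ∈ schattenClass J p ↔
        ∀ (I : Set ℕ) (e : I → H), IsOrthonormalIn J i e → ∑' n, ‖T (e n)‖ₑ ^ p < ∞) ∧
      schattenNorm p T =
        ⨆ (I : Set ℕ) (e : I → H) (_ : IsOrthonormalIn J i e),
          (∑' n, ‖T (e n)‖ₑ ^ p) ^ (1 / p)) ∧
    -- the diagonal sums, for `p ≥ 1`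
    (∀ p : ℝ, 1 ≤ p →
      (T ∈ schattenClass J p ↔
        ∀ (I : Set ℕ) (e : I → H), IsOrthonormalIn J i e →
          ∑' n, ‖inner ℍ (e n) (T (e n))‖ₑ ^ p < ∞) ∧
      (adjoint T = T →
        schattenNorm p T =
          ⨆ (I : Set ℕ) (e : I → H) (_ : IsOrthonormalIn J i e),
            (∑' n, ‖inner ℍ (e n) (T (e n))‖ₑ ^ p) ^ (1 / p))) ∧
    -- the sums over pairs of orthonormal sets, for `p ≥ 1`
    (∀ p : ℝ, 1 ≤ p →
      (T ∈ schattenClass J p ↔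
        ∀ (I : Set ℕ) (e σ : I → H), IsOrthonormalIn J i e → IsOrthonormalIn J i σ →
          ∑' n, ‖inner ℍ (σ n) (T (e n))‖ₑ ^ p < ∞) ∧
      (IsPositive T →
        schattenNorm p T =
          ⨆ (I : Set ℕ) (e : I → H) (σ : I → H) (_ : IsOrthonormalIn J i e)
            (_ : IsOrthonormalIn J i σ),
            (∑' n, ‖inner ℍ (σ n) (T (e n))‖ₑ ^ p) ^ (1 / p))) ∧
    -- the bound by the matrix entries, for `0 < p ≤ 2`
    (∀ p : ℝ, 0 < p → p ≤ 2 →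
      ∀ (I : Set ℕ) (e : I → H), IsOrthonormalBasisOf J i e →
        schattenNorm p T ^ p ≤ ∑' n, ∑' k, ‖inner ℍ (e k) (T (e n))‖ₑ ^ p) := by
  obtain ⟨S, μ, hS, horth, hg⟩ := exists_singularBasis hJ hi_re hi_norm hT hTJ
  have := hS.to_subtype
  -- Reindexed by `φ` and `ψ`, the singular basis and the singular pairs are the extremal families.
  obtain ⟨I₀, ⟨φ⟩⟩ := exists_natSet_equiv S
  obtain ⟨K₀, ⟨ψ⟩⟩ := exists_natSet_equiv {k | μ k ≠ 0}
  have hφ := horth.comp φ.injective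
  have hψ := horth.comp (Subtype.val_injective.comp ψ.injective)
  have hψ' := (horth.image hTJ hg).comp ψ.injective
  have hmem : ∀ {p : ℝ}, 0 < p → (T ∈ schattenClass J p ↔ _) := mem_schattenClass_iff hT hTJ
  refine ⟨fun p hp => ?_, fun p hp => ?_, fun p hp => ?_, fun p hp0 hp I e he => ?_⟩
  · have hp0 : 0 < p := by linarith
    have hle : ∀ (I : Set ℕ) (e : I → H), IsOrthonormalIn J i e →
        ∑' n, ‖T (e n)‖ₑ ^ p ≤ ∑' k, ENNReal.ofReal (μ k) ^ p :=
      fun I e he => hg.tsum_enorm_apply_rpow_le he.1 hp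
    have heq : ∑' n, ‖T (φ n)‖ₑ ^ p = ∑' k, ENNReal.ofReal (μ k) ^ p := by
      rw [φ.tsum_eq fun k : S => ‖T k‖ₑ ^ p]
      simp_rw [hg.enorm_apply]
    rw [hmem hp0, hg.tsum_singularValue hp0, schattenNorm_eq hg hp0]
    refine ⟨⟨fun h I e he => (hle I e he).trans_lt h, fun h => heq ▸ h I₀ _ hφ⟩,
      le_antisymm ?_ (iSup_le fun I => iSup_le fun e => iSup_le fun he =>
        ENNReal.rpow_le_rpow (hle I e he) (by positivity))⟩
    rw [← heq]
    exact le_iSup_of_le I₀ (le_iSup_of_le _ (le_iSup_of_le hφ le_rfl))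
  · have hp0 : 0 < p := by linarith
    refine ⟨?_, fun hs => ?_⟩
    · rw [hmem hp0]
      exact ⟨fun h I e he =>
        (tsum_enorm_inner_rpow_le hJ hi_re hi_norm hT hTJ he.1 he.1 hp).trans_lt h,
        tsum_singularValue_lt_top_of_forall_diagonal hJ hi_re hi_norm hT hTJ hp⟩
    -- An eigenbasis of `T* T` would not do: if `T` swaps two basis vectors, its diagonal there is
    -- 0. Eigenvectors of `T` itself are needed.
    · obtain ⟨S', ν, hS', horth', hg', hν⟩ :=
        exists_selfAdjoint_singularBasis hJ hi_re hi_norm hT hs hTJ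
      have := hS'.to_subtype
      obtain ⟨I₁, ⟨χ⟩⟩ := exists_natSet_equiv S'
      have heq : ∑' n, ‖inner ℍ (χ n : H) (T (χ n))‖ₑ ^ p = ∑' k, ENNReal.ofReal (ν k) ^ p := by
        rw [χ.tsum_eq fun k : S' => ‖inner ℍ (k : H) (T k)‖ₑ ^ p]
        simp_rw [← hν, ofReal_norm]
      rw [schattenNorm_eq hg' hp0]
      refine le_antisymm ?_ (iSup_le fun I => iSup_le fun e => iSup_le fun he =>
        ENNReal.rpow_le_rpow (hg'.tsum_enorm_inner_rpow_le he.1 he.1 hp) (by positivity))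
      rw [← heq]
      exact le_iSup_of_le I₁ (le_iSup_of_le _ (le_iSup_of_le (horth'.comp χ.injective) le_rfl))
  · have hp0 : 0 < p := by linarith
    have heq : ∑' n, ‖inner ℍ (hg.image (ψ n)) (T (ψ n : S))‖ₑ ^ p =
        ∑' k, ENNReal.ofReal (μ k) ^ p := by
      rw [ψ.tsum_eq fun k => ‖inner ℍ (hg.image k) (T (k : S))‖ₑ ^ p,
        hg.tsum_enorm_inner_image hp0]
    rw [hmem hp0, hg.tsum_singularValue hp0, schattenNorm_eq hg hp0]
    refine ⟨⟨fun h I e σ he hσ => (hg.tsum_enorm_inner_rpow_le he.1 hσ.1 hp).trans_lt h,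
      fun h => heq ▸ h K₀ _ _ hψ hψ'⟩, fun _ => le_antisymm ?_ (iSup_le fun I => iSup_le fun e =>
        iSup_le fun σ => iSup_le fun he => iSup_le fun hσ =>
          ENNReal.rpow_le_rpow (hg.tsum_enorm_inner_rpow_le he.1 hσ.1 hp) (by positivity))⟩
    rw [← heq]
    exact le_iSup_of_le K₀ (le_iSup_of_le _ (le_iSup_of_le _ (le_iSup_of_le hψ
      (le_iSup_of_le hψ' le_rfl))))
  · have ht : IsTotal e := isTotal_of_HPlus hJ hi_re hi_norm he.1.2 he.2
    rw [schattenNorm_eq hg hp0, ← ENNReal.rpow_mul, one_div_mul_cancel hp0.ne', ENNReal.rpow_one]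
    refine (hg.tsum_rpow_le he.1.1 ht hp0 hp).trans (ENNReal.tsum_le_tsum fun n => ?_)
    -- Parseval writes `‖T e_n‖ ^ 2` as the sum of the squared entries, and the power `p / 2 ≤ 1` is
    -- subadditive.
    rw [← ennreal_sq_rpow_half, ← tsum_enorm_sq he.1.1 ht]
    refine (rpow_tsum_le_tsum_rpow _ (by positivity : 0 < p / 2) (by linarith)).trans_eq ?_
    simp_rw [ennreal_sq_rpow_half]
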